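/- Let $\Bbbk$ be an algebraically closed field of characteristic $0$. An associative conformal algebra over $\Bbbk$ is a $\Bbbk$-space $C$ with a linear map $\partial$ and bilinear $m$-products $a\circ_m b$ ($m\ge 0$) such that for all $a,b,c\in C$: $a\circ_m b=0$ for all sufficiently large $m$; $\partial a\circ_m b=-m\,(a\circ_{m-1}b)$; $a\circ_m\partial b=\partial(a\circ_m b)+m\,(a\circ_{m-1}b)$; and $a\circ_n(b\circ_m c)=\sum_{s\ge 0}\binom ns (a\circ_{n-s}b)\circ_{m+s}c$. Write $a\circ_\lambda b=\sum_{m\ge 0}\frac{\lambda^m}{m!}(a\circ_m b)$. For a set $X$ and $N\ge 0$ let $\mathrm{ConfAs}(X,N)$ be the free associative conformal algebra generated by $X$ with locality bound $N$ (i.e. $x\circ_m y=0$ for $x,y\in X$, $m\ge N$). We say that $C$ is generated by $X\subseteq C$ with locality bound $N$ relative to a set of defining relations if $X$ generates $C$ and the identity on $X$ extends to an isomorphism onto $C$ of the quotient of $\mathrm{ConfAs}(X,N)$ by the ideal generated by these relations. Let $\mathrm{Cend}_n$ be the space $M_n(\Bbbk[\partial,x])$ with multiplication by $\partial$ and the $\lambda$-product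 $A(\partial,x)\circ_\lambda B(\partial,x)=A(-\lambda,x)B(\partial+\lambda,x+\lambda)$. Let $n\ge 1$, $Q=\mathrm{diag}(1,\dots,1,x)$, and let $C=\mathrm{Cend}_{n,Q}=Q(x)M_n(\Bbbk[\partial,x])$, a conformal subalgebra of $\mathrm{Cend}_n$. Let $e_{ij}$ denote the matrix units and put $x_{ij}=x\,e_{ij}$. (1) $C$ is generated by $X=\{e_{ij}\mid 1\le i\le n-1,\ 1\le j\le n\}\cup\{x_{ij}\mid 1\le i,j\le n\}$ with locality bound $2$ relative to the following defining relations (for all admissible indices): $$e_{ij}\circ_\lambda e_{kl}=\delta_{jk}e_{il},\qquad x_{ij}\circ_\lambda e_{kl}=\delta_{jk}x_{il},\qquad e_{ij}\circ_\lambda x_{kl}=\delta_{jk}(x_{il}+\lambda e_{il}),$$ $$x_{ij}\circ_1 x_{jl}=x_{il},\qquad x_{ij}\circ_\lambda x_{kl}=0\ (j\ne k),\qquad x_{ij}\circ_0 x_{jl}=x_{ik}\circ_0 x_{kl}.$$ (2) If $n\ge 2$, then for every $N\ge 2$ the algebra $C$ is generated by $X'=\{e_{ij}\mid 1\le i,j\le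 n-1\}\cup\{e_{1n},x_{n1}\}$ with locality bound $N$ relative to the following defining relations, where $i,j,k,l\in\{1,\dots,n-1\}$: $$e_{ij}\circ_\lambda e_{kl}=\delta_{jk}e_{il},\qquad e_{1n}\circ_\lambda e_{ij}=0,\qquad e_{11}\circ_\lambda e_{1n}=e_{1n},\qquad e_{ij}\circ_\lambda x_{n1}=0,$$ $$x_{n1}\circ_\lambda e_{11}=x_{n1},\qquad e_{1n}\circ_1 x_{n1}=e_{11},\qquad e_{1n}\circ_m x_{n1}=0\ (m>1).$$ -/

import Mathlib

open Polynomial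

noncomputable section

universe u v w

/-! ## Conformal algebras -/

/-- The operations of a conformal algebra on a `k`-space `C`: a linear map `∂` and a family of
bilinear `m`-products, `m = 0, 1, 2, …`. -/
class ConformalOps (k : Type u) [Field k] (C : Type v) [AddCommGroup C] [Module k C] where
  del : C →ₗ[k] C
  nProd : ℕ → C →ₗ[k] C →ₗ[k] C

/-- The operator `∂`. -/
abbrev del (k : Type u) [Field k] {C : Type v} [AddCommGroup C] [Module k C] [ConformalOps k C]
    (a : C) : C :=
  ConformalOps.del (k := k) a

/-- The `m`-product of `a` and `b`. The `λ`-product of `a` and `b` is the polynomial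
`∑ m, (λ ^ m / m!) (nProd k m a b)`. -/
abbrev nProd (k : Type u) [Field k] {C : Type v} [AddCommGroup C] [Module k C] [ConformalOps k C]
    (m : ℕ) (a b : C) : C :=
  ConformalOps.nProd (k := k) m a b

/-- Associative conformal algebras: locality, the two sesquilinearity axioms, and conformal
associativity. (For `m = 0` the term with index `m - 1` has coefficient `0`.) -/
class IsAssocConformal (k : Type u) [Field k] (C : Type v) [AddCommGroup C] [Module k C]
    [ConformalOps k C] : Prop where
  locality : ∀ a b : C, ∃ N : ℕ, ∀ m, N ≤ m → nProd k m a b = 0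
  del_nProd : ∀ (m : ℕ) (a b : C), nProd k m (del k a) b = -((m : k) • nProd k (m - 1) a b)
  nProd_del : ∀ (m : ℕ) (a b : C),
    nProd k m a (del k b) = del k (nProd k m a b) + (m : k) • nProd k (m - 1) a b
  assoc : ∀ (n m : ℕ) (a b c : C), nProd k n a (nProd k m b c) =
    ∑ s ∈ Finset.range (n + 1), (n.choose s : k) • nProd k (m + s) (nProd k (n - s) a b) c

/-- Isomorphisms of conformal algebras. -/
structure ConfIso (k : Type u) [Field k] (C : Type v) [AddCommGroup C] [Module k C]
    [ConformalOps k C] (D : Type w) [AddCommGroup D] [Module k D] [ConformalOps k D]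
    extends C ≃ₗ[k] D where
  map_del : ∀ a : C, toFun (del k a) = del k (toFun a)
  map_nProd : ∀ (m : ℕ) (a b : C), toFun (nProd k m a b) = nProd k m (toFun a) (toFun b)

/-! ## Conformal subalgebras -/

/-- Conformal subalgebras. -/
structure ConfSubalgebra (k : Type u) [Field k] (C : Type v) [AddCommGroup C] [Module k C]
    [ConformalOps k C] extends Submodule k C where
  del_mem : ∀ a, a ∈ carrier → del k a ∈ carrier
  nProd_mem : ∀ (m : ℕ) (a b : C), a ∈ carrier → b ∈ carrier → nProd k m a b ∈ carrier

section Sub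
variable {k : Type u} [Field k] {C : Type v} [AddCommGroup C] [Module k C] [ConformalOps k C]

/-- The underlying type of a conformal subalgebra. -/
abbrev ConfSubalgebra.Elem (U : ConfSubalgebra k C) : Type v := U.toSubmodule

instance (U : ConfSubalgebra k C) : ConformalOps k U.Elem where
  del := (ConformalOps.del (k := k) (C := C)).restrict U.del_mem
  nProd m := LinearMap.mk₂ k (fun a b => ⟨nProd k m a.1 b.1, U.nProd_mem m _ _ a.2 b.2⟩)
    (fun a b c => Subtype.ext (by simp [nProd])) (fun r a b => Subtype.ext (by simp [nProd]))
    (fun a b c => Subtype.ext (by simp [nProd])) (fun r a b => Subtype.ext (by simp [nProd]))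

instance (U : ConfSubalgebra k C) [IsAssocConformal k C] : IsAssocConformal k U.Elem where
  locality a b := by
    obtain ⟨N, hN⟩ := IsAssocConformal.locality (k := k) a.1 b.1
    exact ⟨N, fun m hm => Subtype.ext (hN m hm)⟩
  del_nProd m a b := Subtype.ext (IsAssocConformal.del_nProd m a.1 b.1)
  nProd_del m a b := Subtype.ext (IsAssocConformal.nProd_del m a.1 b.1)
  assoc n m a b c := Subtype.ext (by
    have h := IsAssocConformal.assoc (k := k) n m a.1 b.1 c.1
    rw [AddSubmonoidClass.coe_finsetSum]
    exact h)

end Sub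

/-- The family `g` generates the conformal algebra `C`: no proper conformal subalgebra
contains all its members. -/
def Generates (k : Type u) [Field k] {C : Type v} [AddCommGroup C] [Module k C]
    [ConformalOps k C] {X : Type w} (g : X → C) : Prop :=
  ∀ U : ConfSubalgebra k C, (∀ x, g x ∈ U.toSubmodule) → ∀ a : C, a ∈ U.toSubmodule

/-! ## Ideals and quotients -/

/-- Ideals: subspaces closed under `∂` and under all left and right `m`-products. -/
structure ConfIdeal (k : Type u) [Field k] (C : Type v) [AddCommGroup C] [Module k C]
    [ConformalOps k C] extends Submodule k C where
  del_mem : ∀ a, a ∈ carrier → del k a ∈ carrier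
  nProd_mem_left : ∀ (m : ℕ) (a b : C), b ∈ carrier → nProd k m a b ∈ carrier
  nProd_mem_right : ∀ (m : ℕ) (a b : C), a ∈ carrier → nProd k m a b ∈ carrier

section Quo
variable {k : Type u} [Field k] {C : Type v} [AddCommGroup C] [Module k C] [ConformalOps k C]

/-- The ideal generated by a set. -/
def ConfIdeal.span (S : Set C) : ConfIdeal k C where
  toSubmodule := ⨅ (I : ConfIdeal k C) (_ : S ⊆ (I.toSubmodule : Set C)), I.toSubmodule
  del_mem a ha := by
    simp only [AddSubsemigroup.mem_carrier, AddSubmonoid.mem_toSubsemigroup,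
      Submodule.mem_toAddSubmonoid, Submodule.mem_iInf] at ha ⊢
    exact fun I hI => I.del_mem a (ha I hI)
  nProd_mem_left m a b hb := by
    simp only [AddSubsemigroup.mem_carrier, AddSubmonoid.mem_toSubsemigroup,
      Submodule.mem_toAddSubmonoid, Submodule.mem_iInf] at hb ⊢
    exact fun I hI => I.nProd_mem_left m a b (hb I hI)
  nProd_mem_right m a b ha := by
    simp only [AddSubsemigroup.mem_carrier, AddSubmonoid.mem_toSubsemigroup,
      Submodule.mem_toAddSubmonoid, Submodule.mem_iInf] at ha ⊢
    exact fun I hI => I.nProd_mem_right m a b (ha I hI)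

theorem ConfIdeal.subset_span (S : Set C) {a : C} (ha : a ∈ S) :
    a ∈ (ConfIdeal.span (k := k) S).toSubmodule := by
  simp only [ConfIdeal.span, Submodule.mem_iInf]
  exact fun I hI => hI ha

/-- The quotient by an ideal. -/
abbrev ConfIdeal.Quo (I : ConfIdeal k C) : Type v := C ⧸ I.toSubmodule

/-- The class of an element in the quotient by an ideal. -/
abbrev ConfIdeal.toQuo (I : ConfIdeal k C) (a : C) : I.Quo := I.toSubmodule.mkQ a

instance (I : ConfIdeal k C) : ConformalOps k I.Quo where
  del := I.toSubmodule.mapQ I.toSubmodule ConformalOps.del I.del_mem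
  nProd m := I.toSubmodule.liftQ
    { toFun := fun a =>
        I.toSubmodule.mapQ I.toSubmodule (ConformalOps.nProd m a) (I.nProd_mem_left m a)
      map_add' := fun a b => by ext c; simp
      map_smul' := fun r a => by ext c; simp }
    (fun a ha => by
      ext b
      simpa using (Submodule.Quotient.mk_eq_zero _).2 (I.nProd_mem_right m a b ha))

theorem ConfIdeal.mk_del (I : ConfIdeal k C) (a : C) : del k (I.toQuo a) = I.toQuo (del k a) := rfl

theorem ConfIdeal.mk_nProd (I : ConfIdeal k C) (m : ℕ) (a b : C) :
    nProd k m (I.toQuo a) (I.toQuo b) = I.toQuo (nProd k m a b) := rfl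

instance (I : ConfIdeal k C) [IsAssocConformal k C] : IsAssocConformal k I.Quo where
  locality a b := by
    obtain ⟨a, rfl⟩ := I.toSubmodule.mkQ_surjective a
    obtain ⟨b, rfl⟩ := I.toSubmodule.mkQ_surjective b
    obtain ⟨N, hN⟩ := IsAssocConformal.locality (k := k) a b
    exact ⟨N, fun m hm => by rw [I.mk_nProd, hN m hm, ConfIdeal.toQuo, map_zero]⟩
  del_nProd m a b := by
    obtain ⟨a, rfl⟩ := I.toSubmodule.mkQ_surjective a
    obtain ⟨b, rfl⟩ := I.toSubmodule.mkQ_surjective b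
    exact congrArg I.toQuo (IsAssocConformal.del_nProd (k := k) m a b)
  nProd_del m a b := by
    obtain ⟨a, rfl⟩ := I.toSubmodule.mkQ_surjective a
    obtain ⟨b, rfl⟩ := I.toSubmodule.mkQ_surjective b
    exact congrArg I.toQuo (IsAssocConformal.nProd_del (k := k) m a b)
  assoc n m a b c := by
    obtain ⟨a, rfl⟩ := I.toSubmodule.mkQ_surjective a
    obtain ⟨b, rfl⟩ := I.toSubmodule.mkQ_surjective b
    obtain ⟨c, rfl⟩ := I.toSubmodule.mkQ_surjective c
    refine (congrArg I.toQuo (IsAssocConformal.assoc (k := k) n m a b c)).trans ?_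
    rw [ConfIdeal.toQuo, map_sum]
    rfl

end Quo

/-! ## Free associative conformal algebras -/

/-- Words in the letters `X`, one unary symbol `∂` and binary symbols `nProd m`, `m ≥ 0`. -/
inductive ConfWord (X : Type v) : Type v
  | of : X → ConfWord X
  | del : ConfWord X → ConfWord X
  | nProd : ℕ → ConfWord X → ConfWord X → ConfWord X

/-- Linear combinations of words: the free space with a linear map `∂` and bilinear
`m`-products, subject to no identities. -/
abbrev ConfTerm (k : Type u) [Field k] (X : Type v) : Type (max u v) := ConfWord X →₀ k

instance (k : Type u) [Field k] (X : Type v) : ConformalOps k (ConfTerm k X) where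
  del := Finsupp.lmapDomain k k ConfWord.del
  nProd m := Finsupp.linearCombination k fun w => Finsupp.lmapDomain k k (ConfWord.nProd m w)

/-- The axioms of an associative conformal algebra, together with the locality of the
generators: `nProd m x y = 0` for all letters `x`, `y` and all `m ≥ N`. -/
inductive ConfAxiom (k : Type u) [Field k] (X : Type v) (N : ℕ) : ConfTerm k X → Prop
  | del_nProd (m : ℕ) (a b : ConfTerm k X) :
      ConfAxiom k X N (nProd k m (del k a) b - -((m : k) • nProd k (m - 1) a b))
  | nProd_del (m : ℕ) (a b : ConfTerm k X) :
      ConfAxiom k X N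
        (nProd k m a (del k b) - (del k (nProd k m a b) + (m : k) • nProd k (m - 1) a b))
  | assoc (n m : ℕ) (a b c : ConfTerm k X) :
      ConfAxiom k X N (nProd k n a (nProd k m b c) -
        ∑ s ∈ Finset.range (n + 1), (n.choose s : k) • nProd k (m + s) (nProd k (n - s) a b) c)
  | locality (x y : X) (m : ℕ) (hm : N ≤ m) :
      ConfAxiom k X N
        (nProd k m (Finsupp.single (ConfWord.of x) 1) (Finsupp.single (ConfWord.of y) 1))

/-- The ideal of consequences of the axioms. -/
def confAxiomIdeal (k : Type u) [Field k] (X : Type v) (N : ℕ) : ConfIdeal k (ConfTerm k X) :=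
  ConfIdeal.span {a | ConfAxiom k X N a}

/-- `ConfAs k X N`: the free associative conformal algebra generated by `X` with locality
bound `N`, i.e. the universal associative conformal algebra generated by `X` in which
`nProd m x y = 0` for all `x, y ∈ X` and `m ≥ N`. -/
abbrev ConfAs (k : Type u) [Field k] (X : Type v) (N : ℕ) : Type (max u v) :=
  (confAxiomIdeal k X N).Quo

/-- The canonical map from `X` to the free associative conformal algebra. -/
def ConfAs.of (k : Type u) [Field k] {X : Type v} (N : ℕ) (x : X) : ConfAs k X N :=
  (confAxiomIdeal k X N).toQuo (Finsupp.single (ConfWord.of x) 1)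

section Dong
variable {k : Type u} [Field k] {C : Type v} [AddCommGroup C] [Module k C] [ConformalOps k C]

/-- Locality of a pair of elements. -/
def IsLocalPair (k : Type u) [Field k] {C : Type v} [AddCommGroup C] [Module k C]
    [ConformalOps k C] (a b : C) : Prop :=
  ∃ N : ℕ, ∀ m, N ≤ m → nProd k m a b = 0

theorem isLocalPair_nProd_left
    (h : ∀ (n m : ℕ) (a b c : C), nProd k n a (nProd k m b c) =
      ∑ s ∈ Finset.range (n + 1), (n.choose s : k) • nProd k (m + s) (nProd k (n - s) a b) c)
    (n : ℕ) (a b c : C) (hbc : IsLocalPair k b c) : IsLocalPair k (nProd k n a b) c := by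
  obtain ⟨N, hN⟩ := hbc
  refine ⟨N, ?_⟩
  induction n using Nat.strong_induction_on with
  | _ n ih =>
    intro m hm
    have h1 := h n m a b c
    rw [hN m hm, Finset.sum_range_succ'] at h1
    rw [Finset.sum_eq_zero] at h1
    · simpa using h1.symm
    · intro s hs
      rw [Finset.mem_range] at hs
      rw [ih (n - (s + 1)) (by omega) (m + (s + 1)) (by omega), smul_zero]

theorem isLocalPair_nProd_right
    (h : ∀ (n m : ℕ) (a b c : C), nProd k n a (nProd k m b c) =
      ∑ s ∈ Finset.range (n + 1), (n.choose s : k) • nProd k (m + s) (nProd k (n - s) a b) c)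
    (m : ℕ) (a b c : C) (hab : IsLocalPair k a b) (hbc : IsLocalPair k b c) :
    IsLocalPair k a (nProd k m b c) := by
  obtain ⟨M, hM⟩ := hab
  have h2 : ∀ B, ∃ K, ∀ n, n < B → ∀ m, K ≤ m → nProd k m (nProd k n a b) c = 0 := by
    intro B
    induction B with
    | zero => exact ⟨0, fun n hn => absurd hn (by omega)⟩
    | succ B ih =>
      obtain ⟨K, hK⟩ := ih
      obtain ⟨L, hL⟩ := isLocalPair_nProd_left h B a b c hbc
      refine ⟨max K L, fun n hn m hm => ?_⟩
      rcases Nat.lt_succ_iff_lt_or_eq.1 hn with h' | rfl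
      · exact hK n h' m (le_trans (le_max_left _ _) hm)
      · exact hL m (le_trans (le_max_right _ _) hm)
  obtain ⟨K, hK⟩ := h2 M
  refine ⟨M + K, fun n hn => ?_⟩
  rw [h]
  refine Finset.sum_eq_zero fun s hs => ?_
  rw [Finset.mem_range] at hs
  by_cases hs' : n - s < M
  · rw [hK _ hs' _ (by omega), smul_zero]
  · rw [hM _ (by omega)]
    simp [nProd]

end Dong

section FreeLocal
variable (k : Type u) [Field k] (X : Type v) (N : ℕ)

theorem confAs_eq {a b : ConfTerm k X} (h : ConfAxiom k X N (a - b)) :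
    (confAxiomIdeal k X N).toQuo a = (confAxiomIdeal k X N).toQuo b :=
  (Submodule.Quotient.eq _).2 (ConfIdeal.subset_span _ h)

theorem confAs_del_nProd (m : ℕ) (a b : ConfAs k X N) :
    nProd k m (del k a) b = -((m : k) • nProd k (m - 1) a b) := by
  obtain ⟨a, rfl⟩ := (confAxiomIdeal k X N).toSubmodule.mkQ_surjective a
  obtain ⟨b, rfl⟩ := (confAxiomIdeal k X N).toSubmodule.mkQ_surjective b
  exact confAs_eq k X N (.del_nProd m a b)

theorem confAs_nProd_del (m : ℕ) (a b : ConfAs k X N) :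
    nProd k m a (del k b) = del k (nProd k m a b) + (m : k) • nProd k (m - 1) a b := by
  obtain ⟨a, rfl⟩ := (confAxiomIdeal k X N).toSubmodule.mkQ_surjective a
  obtain ⟨b, rfl⟩ := (confAxiomIdeal k X N).toSubmodule.mkQ_surjective b
  exact confAs_eq k X N (.nProd_del m a b)

theorem confAs_assoc (n m : ℕ) (a b c : ConfAs k X N) : nProd k n a (nProd k m b c) =
    ∑ s ∈ Finset.range (n + 1), (n.choose s : k) • nProd k (m + s) (nProd k (n - s) a b) c := by
  obtain ⟨a, rfl⟩ := (confAxiomIdeal k X N).toSubmodule.mkQ_surjective a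
  obtain ⟨b, rfl⟩ := (confAxiomIdeal k X N).toSubmodule.mkQ_surjective b
  obtain ⟨c, rfl⟩ := (confAxiomIdeal k X N).toSubmodule.mkQ_surjective c
  refine (confAs_eq k X N (.assoc n m a b c)).trans ?_
  rw [ConfIdeal.toQuo, map_sum]
  rfl

theorem confAs_local_word (v w : ConfWord X) :
    IsLocalPair k ((confAxiomIdeal k X N).toQuo (Finsupp.single v 1))
      ((confAxiomIdeal k X N).toQuo (Finsupp.single w 1)) := by
  have hd : ∀ w : ConfWord X, (confAxiomIdeal k X N).toQuo (Finsupp.single (.del w) 1) =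
      del k ((confAxiomIdeal k X N).toQuo (Finsupp.single w 1)) := by
    intro w
    rw [ConfIdeal.mk_del]
    simp [del, ConformalOps.del]
  have hp : ∀ (m : ℕ) (v w : ConfWord X),
      (confAxiomIdeal k X N).toQuo (Finsupp.single (.nProd m v w) 1) =
      nProd k m ((confAxiomIdeal k X N).toQuo (Finsupp.single v 1))
        ((confAxiomIdeal k X N).toQuo (Finsupp.single w 1)) := by
    intro m v w
    rw [ConfIdeal.mk_nProd]
    simp [nProd, ConformalOps.nProd]
  have hdl : ∀ a b : ConfAs k X N, IsLocalPair k a b → IsLocalPair k (del k a) b := by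
    rintro a b ⟨M, hM⟩
    refine ⟨M + 1, fun m hm => ?_⟩
    rw [confAs_del_nProd, hM (m - 1) (by omega), smul_zero, neg_zero]
  have hdr : ∀ a b : ConfAs k X N, IsLocalPair k a b → IsLocalPair k a (del k b) := by
    rintro a b ⟨M, hM⟩
    refine ⟨M + 1, fun m hm => ?_⟩
    rw [confAs_nProd_del, hM (m - 1) (by omega), hM m (by omega), smul_zero, add_zero]
    simp [del]
  induction w generalizing v with
  | of y =>
    induction v with
    | of x =>
      refine ⟨N, fun m hm => ?_⟩
      rw [ConfIdeal.mk_nProd]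
      exact (Submodule.Quotient.mk_eq_zero _).2 (ConfIdeal.subset_span _ (.locality x y m hm))
    | del v ih => rw [hd]; exact hdl _ _ ih
    | nProd m v v' _ ih =>
      rw [hp]; exact isLocalPair_nProd_left (confAs_assoc k X N) m _ _ _ ih
  | del w ih => rw [hd]; exact hdr _ _ (ih v)
  | nProd m w w' ih ih' =>
    rw [hp]; exact isLocalPair_nProd_right (confAs_assoc k X N) m _ _ _ (ih v) (ih' w)

theorem confAs_local (a b : ConfAs k X N) : IsLocalPair k a b := by
  have hal : ∀ a a' b : ConfAs k X N, IsLocalPair k a b → IsLocalPair k a' b →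
      IsLocalPair k (a + a') b := by
    rintro a a' b ⟨M, hM⟩ ⟨M', hM'⟩
    refine ⟨max M M', fun m hm => ?_⟩
    have h1 := hM m (le_trans (le_max_left _ _) hm)
    have h2 := hM' m (le_trans (le_max_right _ _) hm)
    simp only [nProd] at h1 h2 ⊢
    rw [map_add, LinearMap.add_apply, h1, h2, add_zero]
  have har : ∀ a b b' : ConfAs k X N, IsLocalPair k a b → IsLocalPair k a b' →
      IsLocalPair k a (b + b') := by
    rintro a b b' ⟨M, hM⟩ ⟨M', hM'⟩
    refine ⟨max M M', fun m hm => ?_⟩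
    have h1 := hM m (le_trans (le_max_left _ _) hm)
    have h2 := hM' m (le_trans (le_max_right _ _) hm)
    simp only [nProd] at h1 h2 ⊢
    rw [map_add, h1, h2, add_zero]
  have hsmul : ∀ (r s : k) (a b : ConfAs k X N), IsLocalPair k a b →
      IsLocalPair k (r • a) (s • b) := by
    rintro r s a b ⟨M, hM⟩
    refine ⟨M, fun m hm => ?_⟩
    have h1 := hM m hm
    simp only [nProd] at h1 ⊢
    rw [map_smul, map_smul, LinearMap.smul_apply, h1, smul_zero, smul_zero]
  obtain ⟨a, rfl⟩ := (confAxiomIdeal k X N).toSubmodule.mkQ_surjective a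
  obtain ⟨b, rfl⟩ := (confAxiomIdeal k X N).toSubmodule.mkQ_surjective b
  induction a using Finsupp.induction_linear with
  | zero => exact ⟨0, fun m _ => by simp [nProd]⟩
  | add a a' ih ih' => rw [map_add]; exact hal _ _ _ ih ih'
  | single v r =>
    induction b using Finsupp.induction_linear with
    | zero => exact ⟨0, fun m _ => by simp [nProd]⟩
    | add b b' ih ih' => rw [map_add]; exact har _ _ _ ih ih'
    | single w s =>
      have h := hsmul r s _ _ (confAs_local_word k X N v w)
      simpa only [ConfIdeal.toQuo, ← map_smul, Finsupp.smul_single, smul_eq_mul, mul_one] using h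

instance : IsAssocConformal k (ConfAs k X N) where
  locality := confAs_local k X N
  del_nProd := confAs_del_nProd k X N
  nProd_del := confAs_nProd_del k X N
  assoc := confAs_assoc k X N

end FreeLocal

/-! ## Presentations -/

/-- The ideal of the free associative conformal algebra generated by the differences `a - b`
of the two sides of the relations `a = b` in `R`. -/
def relIdeal {k : Type u} [Field k] {X : Type v} {N : ℕ}
    (R : ConfAs k X N → ConfAs k X N → Prop) : ConfIdeal k (ConfAs k X N) :=
  ConfIdeal.span {c | ∃ a b, R a b ∧ c = a - b}

/-- `ConfAs(X, N ∣ R)`: the associative conformal algebra generated by `X` with locality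
bound `N` relative to the defining relations `R`. -/
abbrev ConfAsRel {k : Type u} [Field k] {X : Type v} {N : ℕ}
    (R : ConfAs k X N → ConfAs k X N → Prop) : Type (max u v) :=
  (relIdeal R).Quo

/-- The conformal algebra `C` is generated by the family `g` (with locality bound `N`) relative
to the defining relations `R`: the family `g` generates `C`, and `x ↦ g x` extends to an
isomorphism of conformal algebras `ConfAs(X, N ∣ R) ≃ C`. -/
def IsPresentedBy {k : Type u} [Field k] {C : Type w} [AddCommGroup C] [Module k C]
    [ConformalOps k C] {X : Type v} (g : X → C) (N : ℕ)
    (R : ConfAs k X N → ConfAs k X N → Prop) : Prop :=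
  Generates k g ∧
    ∃ ψ : ConfIso k (ConfAsRel R) C, ∀ x, ψ.toLinearEquiv ((relIdeal R).toQuo (ConfAs.of k N x)) = g x

/-! ## The conformal algebras `Cend_n` and `Cend_{n,Q}` -/

/-- The commutative algebra `k[∂, x]` of polynomials in two variables, realized as
`k[X][X]`: the outer variable is `∂`, the inner variable is `x`. -/
def PolyDX (k : Type u) [Field k] : Type u := k[X][X]

namespace PolyDX

instance (k : Type u) [Field k] : CommRing (PolyDX k) := inferInstanceAs (CommRing k[X][X])
instance (k : Type u) [Field k] : Algebra k (PolyDX k) := inferInstanceAs (Algebra k k[X][X])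

variable (k : Type u) [Field k]

/-- The variable `∂`. -/
def pd : PolyDX k := (X : k[X][X])

/-- The inclusion `k[x] ⊆ k[∂, x]`. -/
def ofX : k[X] →ₐ[k] PolyDX k := (CAlgHom : k[X] →ₐ[k] k[X][X])

/-- The variable `x`. -/
def px : PolyDX k := ofX k X

variable {k}

/-- The evaluation `f(∂, x) ↦ f(D, ξ)` at elements `D`, `ξ` of a commutative `k`-algebra. -/
def subst {R : Type v} [CommRing R] [Algebra k R] (D ξ : R) : PolyDX k →ₐ[k] R :=
  (eval₂AlgHom (aeval ξ) D (fun _ => Commute.all _ _) : k[X][X] →ₐ[k] R)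

theorem subst_pd {R : Type v} [CommRing R] [Algebra k R] (D ξ : R) :
    subst (k := k) D ξ (pd k) = D := by
  change eval₂ _ D (X : k[X][X]) = D
  exact eval₂_X _ _

theorem subst_ofX {R : Type v} [CommRing R] [Algebra k R] (D ξ : R) (f : k[X]) :
    subst (k := k) D ξ (ofX k f) = aeval ξ f := by
  change eval₂ _ D (C f : k[X][X]) = _
  exact eval₂_C _ _

theorem subst_px {R : Type v} [CommRing R] [Algebra k R] (D ξ : R) :
    subst (k := k) D ξ (px k) = ξ := by
  rw [px, subst_ofX, aeval_X]

/-- Every element of `k[∂, x]` is a sum of elements `∂ ^ i f(x)`. -/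
theorem induction {P : PolyDX k → Prop} (a : PolyDX k) (hof : ∀ f, P (ofX k f))
    (hadd : ∀ a b, P a → P b → P (a + b)) (hd : ∀ a, P a → P (pd k * a)) : P a := by
  have h : ∀ (i : ℕ) (f : k[X]), P (monomial i f : k[X][X]) := by
    intro i f
    induction i with
    | zero => exact hof f
    | succ i ih =>
      have hX : (monomial (i + 1) f : k[X][X]) = X * monomial i f := by rw [X_mul_monomial]
      rw [hX]
      exact hd _ ih
  exact Polynomial.induction_on' (motive := P) a hadd h

theorem algHom_ext {R : Type v} [CommRing R] [Algebra k R] {f g : PolyDX k →ₐ[k] R}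
    (hd : f (pd k) = g (pd k)) (hx : f (px k) = g (px k)) : f = g := by
  have h : f.comp (ofX k) = g.comp (ofX k) := Polynomial.algHom_ext hx
  refine AlgHom.ext fun a => ?_
  induction a using PolyDX.induction with
  | hof p => exact DFunLike.congr_fun h p
  | hadd a b ha hb => rw [map_add, map_add, ha, hb]
  | hd a ha => rw [map_mul, map_mul, ha, hd]

variable (k)

/-- `f(∂, x) ↦ f(-λ, x)`. Polynomials in `λ` with coefficients in `k[∂, x]` are elements of
`(PolyDX k)[X]`. -/
def substL : PolyDX k →ₐ[k] (PolyDX k)[X] := subst (-X) (C (px k))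

/-- `f(∂, x) ↦ f(∂ + λ, x + λ)`. -/
def substR : PolyDX k →ₐ[k] (PolyDX k)[X] := subst (C (pd k) + X) (C (px k) + X)

theorem substL_ofX (f : k[X]) : substL k (ofX k f) = C (ofX k f) := by
  rw [substL, subst_ofX]
  have h := aeval_algHom_apply ((CAlgHom : PolyDX k →ₐ[k] (PolyDX k)[X]).comp (ofX k)) X f
  rw [aeval_X_left_apply] at h
  exact h

theorem substR_ofX (f : k[X]) : ∃ p : k[X][X], substR k (ofX k f) = p.map (ofX k : k[X] →+* _) := by
  refine ⟨aeval (C X + X : k[X][X]) f, ?_⟩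
  rw [substR, subst_ofX]
  have h := aeval_algHom_apply (mapAlgHom (ofX k)) (C X + X : k[X][X]) f
  simp only [map_add, coe_mapAlgHom, map_C, map_X] at h
  exact h

theorem substR_coeff_zero (a : PolyDX k) : (substR k a).coeff 0 = a := by
  have h : ((aeval (0 : PolyDX k)).restrictScalars k).comp (substR k) = AlgHom.id k _ := by
    apply algHom_ext
    · simp [substR, subst_pd]
    · simp [substR, subst_px]
  have h1 := DFunLike.congr_fun h a
  rw [coeff_zero_eq_eval_zero, ← coe_aeval_eq_eval]
  exact h1

theorem substR_derivative (a : PolyDX k) :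
    derivative (substR k a) = substR k ((substR k a).coeff 1) := by
  have hmul : ∀ a b : PolyDX k, (∃ d, derivative (substR k a) = substR k d) →
      (∃ d, derivative (substR k b) = substR k d) →
      ∃ d, derivative (substR k (a * b)) = substR k d := by
    rintro a b ⟨d, hd⟩ ⟨e, he⟩
    exact ⟨d * b + a * e, by simp [derivative_mul, hd, he]⟩
  have hadd : ∀ a b : PolyDX k, (∃ d, derivative (substR k a) = substR k d) →
      (∃ d, derivative (substR k b) = substR k d) →
      ∃ d, derivative (substR k (a + b)) = substR k d := by
    rintro a b ⟨d, hd⟩ ⟨e, he⟩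
    exact ⟨d + e, by simp [hd, he]⟩
  have hX : ∃ d, derivative (substR k (pd k)) = substR k d := ⟨1, by simp [substR, subst_pd]⟩
  have hCX : ∃ d, derivative (substR k (px k)) = substR k d := ⟨1, by simp [substR, subst_px]⟩
  have hCC : ∀ r : k, ∃ d, derivative (substR k (algebraMap k _ r)) = substR k d := fun r =>
    ⟨0, by
      rw [AlgHom.commutes, map_zero, Polynomial.algebraMap_apply]
      exact derivative_C⟩
  have hC : ∀ f : k[X], ∃ d, derivative (substR k (ofX k f)) = substR k d := by
    intro f
    induction f using Polynomial.induction_on with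
    | C r => exact hCC r
    | add f g hf hg => rw [map_add]; exact hadd _ _ hf hg
    | monomial n r ih => rw [pow_succ, ← mul_assoc, map_mul]; exact hmul _ _ ih hCX
  obtain ⟨d, hd⟩ : ∃ d, derivative (substR k a) = substR k d := by
    induction a using PolyDX.induction with
    | hof f => exact hC f
    | hadd f g hf hg => exact hadd _ _ hf hg
    | hd a ih => exact hmul _ _ hX ih
  have h1 := congrArg (fun p => p.coeff 0) hd
  simp only [coeff_derivative, substR_coeff_zero] at h1
  rw [hd, ← h1]
  simp

/-- `b ↦ m! [λ ^ m] b(∂ + λ, x + λ)`. -/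
def taylorOp (m : ℕ) (b : PolyDX k) : PolyDX k := (m.factorial : k) • (substR k b).coeff m

theorem taylorOp_succ (m : ℕ) (b : PolyDX k) :
    taylorOp k (m + 1) b = taylorOp k m ((substR k b).coeff 1) := by
  rw [taylorOp, taylorOp, ← substR_derivative, coeff_derivative, Nat.factorial_succ]
  rw [Nat.cast_mul, mul_comm, mul_smul, mul_comm (coeff _ _)]
  congr 1
  rw [← Nat.cast_succ, Nat.cast_smul_eq_nsmul, nsmul_eq_mul]

theorem taylorOp_add (n m : ℕ) (b : PolyDX k) :
    taylorOp k n (taylorOp k m b) = taylorOp k (m + n) b := by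
  have h : ∀ m b, taylorOp k m b = (fun b => (substR k b).coeff 1)^[m] b := by
    intro m
    induction m with
    | zero => intro b; simp [taylorOp, substR_coeff_zero]
    | succ m ih => intro b; rw [taylorOp_succ, ih]; rfl
  rw [h, h, h, add_comm m n, Function.iterate_add_apply]

theorem taylorOp_mul (n : ℕ) (b c : PolyDX k) : taylorOp k n (b * c) =
    ∑ s ∈ Finset.range (n + 1), (n.choose s : k) • (taylorOp k (n - s) b * taylorOp k s c) := by
  simp only [taylorOp]
  rw [map_mul, mul_comm, coeff_mul, Finset.Nat.sum_antidiagonal_eq_sum_range_succ_mk,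
    Finset.smul_sum]
  refine Finset.sum_congr rfl fun s hs => ?_
  have hs' : s ≤ n := by simpa [Nat.lt_succ_iff] using hs
  rw [smul_mul_smul_comm, smul_smul, mul_comm (coeff _ s)]
  congr 1
  rw [← Nat.choose_mul_factorial_mul_factorial hs']
  push_cast
  ring

/-- The `m`-product of `k[∂, x]`: `m!` times the coefficient at `λ ^ m` of
`a(-λ, x) b(∂ + λ, x + λ)`. -/
def scProd (m : ℕ) : PolyDX k →ₗ[k] PolyDX k →ₗ[k] PolyDX k :=
  LinearMap.mk₂ k (fun a b => (m.factorial : k) • (substL k a * substR k b).coeff m)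
    (fun a a' b => by simp [add_mul]) (fun r a b => by simp [smul_comm r])
    (fun a b b' => by simp [mul_add]) (fun r a b => by simp [smul_comm r])

theorem scProd_apply (m : ℕ) (a b : PolyDX k) :
    scProd k m a b = (m.factorial : k) • (substL k a * substR k b).coeff m := rfl

theorem scProd_ofX (m : ℕ) (f : k[X]) (b : PolyDX k) :
    scProd k m (ofX k f) b = ofX k f * taylorOp k m b := by
  rw [scProd_apply, substL_ofX, coeff_C_mul, taylorOp, mul_smul_comm]

theorem scProd_pd_left (m : ℕ) (a b : PolyDX k) :
    scProd k m (pd k * a) b = -((m : k) • scProd k (m - 1) a b) := by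
  have h : substL k (pd k * a) * substR k b = -(X * (substL k a * substR k b)) := by
    rw [map_mul, substL, subst_pd]
    ring
  simp only [scProd_apply, h]
  cases m with
  | zero => simp
  | succ m =>
    rw [coeff_neg, coeff_X_mul, smul_neg, smul_smul, Nat.add_sub_cancel,
      Nat.factorial_succ, Nat.cast_mul]

theorem scProd_pd_right (m : ℕ) (a b : PolyDX k) :
    scProd k m a (pd k * b) = pd k * scProd k m a b + (m : k) • scProd k (m - 1) a b := by
  have h : substL k a * substR k (pd k * b) =
      C (pd k) * (substL k a * substR k b) + X * (substL k a * substR k b) := by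
    rw [map_mul, substR, subst_pd]
    ring
  simp only [scProd_apply, h]
  cases m with
  | zero => simp
  | succ m =>
    rw [coeff_add, coeff_C_mul, coeff_X_mul, smul_add, smul_smul, Nat.add_sub_cancel,
      mul_smul_comm, Nat.factorial_succ, Nat.cast_mul]

theorem scProd_assoc (n m : ℕ) (a b c : PolyDX k) : scProd k n a (scProd k m b c) =
    ∑ s ∈ Finset.range (n + 1), (n.choose s : k) • scProd k (m + s) (scProd k (n - s) a b) c := by
  induction a using PolyDX.induction generalizing n with
  | hadd a a' h h' =>
    simp only [map_add, LinearMap.add_apply, h, h', smul_add, Finset.sum_add_distrib]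
  | hd a ih =>
    rw [scProd_pd_left, ih, Finset.smul_sum]
    simp only [scProd_pd_left, map_neg, map_smul, LinearMap.neg_apply, LinearMap.smul_apply,
      smul_neg, Finset.sum_neg_distrib, neg_inj]
    cases n with
    | zero => simp
    | succ n =>
      conv_rhs => rw [Finset.sum_range_succ]
      simp only [Nat.add_sub_cancel, Nat.sub_self, Nat.cast_zero, zero_smul, smul_zero, add_zero]
      refine Finset.sum_congr rfl fun s hs => ?_
      rw [smul_smul, smul_smul, show n + 1 - s - 1 = n - s by omega]
      congr 1
      rw [← Nat.cast_mul, ← Nat.cast_mul, ← Nat.choose_mul_succ_eq, mul_comm]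
  | hof f =>
    induction b using PolyDX.induction generalizing n m with
    | hadd b b' h h' =>
      simp only [map_add, LinearMap.add_apply, h, h', smul_add, Finset.sum_add_distrib]
    | hof g =>
      simp only [scProd_ofX, taylorOp_mul, taylorOp_add, Finset.mul_sum]
      refine Finset.sum_congr rfl fun s _ => ?_
      obtain ⟨p, hp⟩ := substR_ofX k g
      have h1 : taylorOp k (n - s) (ofX k g) =
          ofX k (((n - s).factorial : k) • p.coeff (n - s)) := by
        rw [taylorOp, hp, coeff_map, map_smul]
        rfl
      rw [h1, ← map_mul, scProd_ofX, map_mul, mul_smul_comm, mul_assoc]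
    | hd b ih =>
      rw [scProd_pd_left, map_neg, map_smul, ih]
      simp only [scProd_pd_right, map_add, map_smul, LinearMap.add_apply, LinearMap.smul_apply,
        scProd_pd_left, smul_add, smul_neg, Finset.sum_add_distrib, Finset.sum_neg_distrib,
        Finset.smul_sum, smul_smul]
      set Y : ℕ → ℕ → PolyDX k := fun p q => scProd k q (scProd k p (ofX k f) b) c with hY
      have key : ∑ s ∈ Finset.range (n + 1), ((n.choose s : k) * ((n - s : ℕ) : k)) •
            Y (n - s - 1) (m + s) =
          ∑ s ∈ Finset.range (n + 1), ((n.choose s : k) * (s : k)) • Y (n - s) (m + s - 1) := by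
        rw [Finset.sum_range_succ, Finset.sum_range_succ' _ n]
        simp only [Nat.sub_self, Nat.cast_zero, mul_zero, zero_smul, add_zero]
        refine Finset.sum_congr rfl fun s hs => ?_
        rw [show n - (s + 1) = n - s - 1 by omega, show m + (s + 1) - 1 = m + s by omega]
        congr 1
        rw [← Nat.cast_mul, ← Nat.cast_mul, Nat.choose_succ_right_eq]
      change -∑ s ∈ Finset.range (n + 1), ((m : k) * (n.choose s : k)) • Y (n - s) (m - 1 + s) =
        -∑ s ∈ Finset.range (n + 1), ((n.choose s : k) * ((m + s : ℕ) : k)) •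
          Y (n - s) (m + s - 1) +
        ∑ s ∈ Finset.range (n + 1), ((n.choose s : k) * ((n - s : ℕ) : k)) • Y (n - s - 1) (m + s)
      rw [key, neg_add_eq_sub, ← Finset.sum_sub_distrib, ← Finset.sum_neg_distrib]
      refine Finset.sum_congr rfl fun s _ => ?_
      rw [← sub_smul, ← neg_smul]
      rcases m with _ | m
      · simp
      · rw [show m + 1 - 1 + s = m + 1 + s - 1 by omega]
        congr 1
        push_cast
        ring

end PolyDX

/-- The underlying space of `Cend_n`: the matrices `M_n(k[∂, x])`. -/
abbrev Cend (k : Type u) [Field k] (n : ℕ) : Type u := Matrix (Fin n) (Fin n) (PolyDX k)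

namespace Cend
variable {k : Type u} [Field k] {n : ℕ}

/-- The `λ`-product `A(-λ, x) B(∂ + λ, x + λ)` of `Cend_n`. -/
def lamProd (A B : Cend k n) : Matrix (Fin n) (Fin n) (PolyDX k)[X] :=
  A.map (PolyDX.substL k) * B.map (PolyDX.substR k)

/-- `∂` acts by multiplication, and the `m`-product is `m!` times the coefficient of the
`λ`-product at `λ ^ m`. -/
instance : ConformalOps k (Cend k n) where
  del :=
    { toFun := fun A => A.map (fun f => PolyDX.pd k * f)
      map_add' := fun A B => by ext1 i j; simp [mul_add]
      map_smul' := fun r A => by ext1 i j; simp }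
  nProd m := LinearMap.mk₂ k
    (fun A B => (m.factorial : k) • (lamProd A B).map (fun p => p.coeff m))
    (fun A A' B => by
      ext1 i j
      simp [lamProd, Matrix.mul_apply, add_mul, Finset.sum_add_distrib, smul_add])
    (fun r A B => by
      ext1 i j
      simp [lamProd, Matrix.mul_apply, Finset.smul_sum, smul_comm r])
    (fun A B B' => by
      ext1 i j
      simp [lamProd, Matrix.mul_apply, mul_add, Finset.sum_add_distrib, smul_add])
    (fun r A B => by
      ext1 i j
      simp [lamProd, Matrix.mul_apply, Finset.smul_sum, smul_comm r])

theorem nProd_eq (m : ℕ) (A B : Cend k n) :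
    nProd k m A B = (m.factorial : k) • (lamProd A B).map (fun p => p.coeff m) := rfl

theorem nProd_apply (m : ℕ) (A B : Cend k n) (i j : Fin n) :
    nProd k m A B i j = ∑ l, PolyDX.scProd k m (A i l) (B l j) := by
  rw [nProd_eq]
  simp [lamProd, Matrix.mul_apply, PolyDX.scProd_apply, Finset.smul_sum]

theorem del_apply (A : Cend k n) (i j : Fin n) : del k A i j = PolyDX.pd k * A i j := rfl

instance : IsAssocConformal k (Cend k n) where
  locality A B := by
    refine ⟨(Finset.univ.sup fun p : Fin n × Fin n =>
      (lamProd A B p.1 p.2).natDegree) + 1, fun m hm => ?_⟩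
    ext1 i j
    have h1 := Finset.le_sup (f := fun p : Fin n × Fin n =>
      (lamProd A B p.1 p.2).natDegree) (Finset.mem_univ (i, j))
    have h2 : (lamProd A B i j).coeff m = 0 :=
      coeff_eq_zero_of_natDegree_lt (lt_of_le_of_lt h1 hm)
    simp [nProd_eq, h2]
  del_nProd m A B := by
    ext1 i j
    simp only [nProd_apply, del_apply, PolyDX.scProd_pd_left, Matrix.neg_apply,
      Matrix.smul_apply, Finset.smul_sum, Finset.sum_neg_distrib]
  nProd_del m A B := by
    ext1 i j
    simp only [nProd_apply, del_apply, PolyDX.scProd_pd_right, Matrix.add_apply,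
      Matrix.smul_apply, Finset.smul_sum, Finset.mul_sum, Finset.sum_add_distrib]
  assoc p m A B D := by
    ext1 i j
    simp only [nProd_apply, Matrix.sum_apply, Matrix.smul_apply, map_sum, LinearMap.sum_apply,
      PolyDX.scProd_assoc, Finset.smul_sum]
    rw [Finset.sum_comm]
    rw [Finset.sum_congr rfl fun l _ => Finset.sum_comm, Finset.sum_comm]

end Cend

/-- `Cend_{n,Q} = Q(x) M_n(k[∂, x])`, a conformal subalgebra of `Cend_n`. -/
def CendQ {k : Type u} [Field k] {n : ℕ} (Q : Matrix (Fin n) (Fin n) k[X]) :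
    ConfSubalgebra k (Cend k n) where
  carrier := {A | ∃ B : Cend k n, A = Q.map (PolyDX.ofX k) * B}
  zero_mem' := ⟨0, by simp⟩
  add_mem' := by
    rintro _ _ ⟨A, rfl⟩ ⟨B, rfl⟩
    exact ⟨A + B, by rw [mul_add]⟩
  smul_mem' := by
    rintro r _ ⟨A, rfl⟩
    exact ⟨r • A, by rw [mul_smul_comm]⟩
  del_mem := by
    rintro _ ⟨A, rfl⟩
    refine ⟨del k A, ?_⟩
    ext1 i j
    simp only [Cend.del_apply, Matrix.mul_apply, Finset.mul_sum]
    exact Finset.sum_congr rfl fun l _ => mul_left_comm _ _ _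
  nProd_mem := by
    rintro m _ B ⟨A, rfl⟩ -
    refine ⟨nProd k m A B, ?_⟩
    have h : Cend.lamProd (Q.map (PolyDX.ofX k) * A) B =
        (Q.map (PolyDX.ofX k)).map C * Cend.lamProd A B := by
      rw [Cend.lamProd, Cend.lamProd, ← Matrix.mul_assoc]
      congr 1
      ext1 i j
      simp [Matrix.mul_apply, PolyDX.substL_ofX]
    rw [Cend.nProd_eq, Cend.nProd_eq, h, mul_smul_comm]
    congr 1
    ext1 i j
    simp [Matrix.mul_apply]

/-! ## `Q = diag(1, …, 1, x)`: generators and relations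

Indices `1, …, n` are represented by `Fin n`; thus `i.val + 1 = n` says that `i` is the last
index. -/

/-- `diag(1, …, 1, x)`. -/
def diagQ (k : Type u) [Field k] (n : ℕ) : Matrix (Fin n) (Fin n) k[X] :=
  Matrix.diagonal fun i => if i.val + 1 = n then X else 1

/-- The set of symbols `e_{ij}` (`i < n`, `j ≤ n`) and `x_{ij}` (`i, j ≤ n`). -/
inductive Gen (n : ℕ) : Type
  | e (i j : Fin n) (hi : i.val + 1 < n) : Gen n
  | x (i j : Fin n) : Gen n

/-- The matrices over `k[∂, x]` named by the symbols: `e_{ij}` is the matrix unit `E_{ij}`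
and `x_{ij}` is `x E_{ij}`. -/
def Gen.toMatrix (k : Type u) [Field k] {n : ℕ} : Gen n → Cend k n
  | .e i j _ => Matrix.single i j 1
  | .x i j => Matrix.single i j (PolyDX.px k)

theorem Gen.toMatrix_mem (k : Type u) [Field k] {n : ℕ} (g : Gen n) :
    g.toMatrix k ∈ (CendQ (diagQ k n)).toSubmodule := by
  have hQ : (diagQ k n).map (PolyDX.ofX k) =
      Matrix.diagonal fun i => if i.val + 1 = n then PolyDX.px k else 1 := by
    ext i j
    simp only [diagQ, Matrix.map_apply, Matrix.diagonal_apply]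
    split_ifs <;> simp [PolyDX.px]
  cases g with
  | e i j hi =>
    refine ⟨Matrix.single i j 1, ?_⟩
    ext a b
    rw [hQ, Matrix.diagonal_mul, toMatrix]
    by_cases ha : i = a
    · subst ha; simp [hi.ne]
    · simp [ha]
  | x i j =>
    refine ⟨Matrix.single i j (if i.val + 1 = n then 1 else PolyDX.px k), ?_⟩
    ext a b
    rw [hQ, Matrix.diagonal_mul, toMatrix]
    by_cases ha : i = a
    · subst ha
      by_cases hb : j = b
      · subst hb
        by_cases hi : i.val + 1 = n <;> simp [hi]
      · simp [hb]
    · simp [ha]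

/-- The generators `e_{ij} = E_{ij}`, `x_{ij} = x E_{ij}` of `Cend_{n,Q}`. -/
def genCendQ (k : Type u) [Field k] {n : ℕ} (g : Gen n) : (CendQ (diagQ k n)).Elem :=
  ⟨g.toMatrix k, g.toMatrix_mem k⟩

/-- The coefficients, with respect to the divided powers `λ ^ m / m!`, of the polynomial
`c₀ + λ c₁`. Hence `a ∘_λ b = c₀ + λ c₁` means `nProd k m a b = lamPoly c₀ c₁ m` for all `m`. -/
def lamPoly {A : Type v} [Zero A] (c₀ c₁ : A) : ℕ → A
  | 0 => c₀
  | 1 => c₁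
  | _ + 2 => 0

/-- The symbol `e_{ij}` in the free associative conformal algebra `ConfAs(X, 2)`. -/
def eSym (k : Type u) [Field k] {n : ℕ} (i j : Fin n) (hi : i.val + 1 < n) :
    ConfAs k (Gen n) 2 :=
  ConfAs.of k 2 (Gen.e i j hi)

/-- The symbol `x_{ij}` in the free associative conformal algebra `ConfAs(X, 2)`. -/
def xSym (k : Type u) [Field k] {n : ℕ} (i j : Fin n) : ConfAs k (Gen n) 2 :=
  ConfAs.of k 2 (Gen.x i j)

/-- The defining relations
* `e_{ij} ∘_λ e_{kl} = δ_{jk} e_{il}`,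
* `x_{ij} ∘_λ e_{kl} = δ_{jk} x_{il}`,
* `e_{ij} ∘_λ x_{kl} = δ_{jk} (x_{il} + λ e_{il})`,
* `x_{ij} ∘_1 x_{jl} = x_{il}`,
* `x_{ij} ∘_λ x_{kl} = 0` for `j ≠ k`,
* `x_{ij} ∘_0 x_{jl} = x_{ik} ∘_0 x_{kl}`. -/
inductive DefRel (k : Type u) [Field k] (n : ℕ) :
    ConfAs k (Gen n) 2 → ConfAs k (Gen n) 2 → Prop
  | ee (i j p l : Fin n) (hi : i.val + 1 < n) (hp : p.val + 1 < n) (m : ℕ) :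
      DefRel k n (nProd k m (eSym k i j hi) (eSym k p l hp))
        (lamPoly (if j = p then eSym k i l hi else 0) 0 m)
  | xe (i j p l : Fin n) (hp : p.val + 1 < n) (m : ℕ) :
      DefRel k n (nProd k m (xSym k i j) (eSym k p l hp))
        (lamPoly (if j = p then xSym k i l else 0) 0 m)
  | ex (i j p l : Fin n) (hi : i.val + 1 < n) (m : ℕ) :
      DefRel k n (nProd k m (eSym k i j hi) (xSym k p l))
        (lamPoly (if j = p then xSym k i l else 0) (if j = p then eSym k i l hi else 0) m)
  | xx_one (i j l : Fin n) :
      DefRel k n (nProd k 1 (xSym k i j) (xSym k j l)) (xSym k i l)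
  | xx_ne (i j p l : Fin n) (hjp : j ≠ p) (m : ℕ) :
      DefRel k n (nProd k m (xSym k i j) (xSym k p l)) 0
  | xx_zero (i j p l : Fin n) :
      DefRel k n (nProd k 0 (xSym k i j) (xSym k j l)) (nProd k 0 (xSym k i p) (xSym k p l))

/-- The smaller set of symbols `e_{ij}` (`i, j < n`), `e_{1n}`, `x_{n1}`. -/
inductive Gen' (n : ℕ) : Type
  | e (i j : Fin n) (hi : i.val + 1 < n) (hj : j.val + 1 < n) : Gen' n
  | e1n : Gen' n
  | xn1 : Gen' n

/-- The smaller set of symbols as a subset of the larger one. -/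
def Gen'.toGen {n : ℕ} (hn : 2 ≤ n) : Gen' n → Gen n
  | .e i j hi _ => .e i j hi
  | .e1n => .e ⟨0, by omega⟩ ⟨n - 1, by omega⟩ (show 0 + 1 < n by omega)
  | .xn1 => .x ⟨n - 1, by omega⟩ ⟨0, by omega⟩

/-- The symbol `e_{ij}`, `i, j < n`, in `ConfAs(X', N)`. -/
def eSym' (k : Type u) [Field k] {n : ℕ} (N : ℕ) (i j : Fin n) (hi : i.val + 1 < n)
    (hj : j.val + 1 < n) : ConfAs k (Gen' n) N :=
  ConfAs.of k N (Gen'.e i j hi hj)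

/-- The symbol `e_{11}` in `ConfAs(X', N)`. -/
def e11Sym' (k : Type u) [Field k] {n : ℕ} (N : ℕ) (hn : 2 ≤ n) : ConfAs k (Gen' n) N :=
  eSym' k N ⟨0, by omega⟩ ⟨0, by omega⟩ (show 0 + 1 < n by omega) (show 0 + 1 < n by omega)

/-- The symbol `e_{1n}` in `ConfAs(X', N)`. -/
def e1nSym' (k : Type u) [Field k] (n N : ℕ) : ConfAs k (Gen' n) N := ConfAs.of k N Gen'.e1n

/-- The symbol `x_{n1}` in `ConfAs(X', N)`. -/
def xn1Sym' (k : Type u) [Field k] (n N : ℕ) : ConfAs k (Gen' n) N := ConfAs.of k N Gen'.xn1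

/-- The defining relations, with `i, j, p, l < n`,
* `e_{ij} ∘_λ e_{pl} = δ_{jp} e_{il}`,
* `e_{1n} ∘_λ e_{ij} = 0`,
* `e_{11} ∘_λ e_{1n} = e_{1n}`,
* `e_{ij} ∘_λ x_{n1} = 0`,
* `x_{n1} ∘_λ e_{11} = x_{n1}`,
* `e_{1n} ∘_1 x_{n1} = e_{11}`, and `e_{1n} ∘_m x_{n1} = 0` for `m > 1`. -/
inductive DefRel' (k : Type u) [Field k] (n : ℕ) (hn : 2 ≤ n) (N : ℕ) :
    ConfAs k (Gen' n) N → ConfAs k (Gen' n) N → Prop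
  | ee (i j p l : Fin n) (hi : i.val + 1 < n) (hj : j.val + 1 < n) (hp : p.val + 1 < n)
      (hl : l.val + 1 < n) (m : ℕ) :
      DefRel' k n hn N (nProd k m (eSym' k N i j hi hj) (eSym' k N p l hp hl))
        (lamPoly (if j = p then eSym' k N i l hi hl else 0) 0 m)
  | e1n_e (i j : Fin n) (hi : i.val + 1 < n) (hj : j.val + 1 < n) (m : ℕ) :
      DefRel' k n hn N (nProd k m (e1nSym' k n N) (eSym' k N i j hi hj)) 0
  | e11_e1n (m : ℕ) :
      DefRel' k n hn N (nProd k m (e11Sym' k N hn) (e1nSym' k n N)) (lamPoly (e1nSym' k n N) 0 m)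
  | e_xn1 (i j : Fin n) (hi : i.val + 1 < n) (hj : j.val + 1 < n) (m : ℕ) :
      DefRel' k n hn N (nProd k m (eSym' k N i j hi hj) (xn1Sym' k n N)) 0
  | xn1_e11 (m : ℕ) :
      DefRel' k n hn N (nProd k m (xn1Sym' k n N) (e11Sym' k N hn)) (lamPoly (xn1Sym' k n N) 0 m)
  | e1n_xn1_one :
      DefRel' k n hn N (nProd k 1 (e1nSym' k n N) (xn1Sym' k n N)) (e11Sym' k N hn)
  | e1n_xn1_gt (m : ℕ) (hm : 1 < m) :
      DefRel' k n hn N (nProd k m (e1nSym' k n N) (xn1Sym' k n N)) 0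

end

/-!
The algebra `A` given by the generators and relations maps to `Cend_{n,Q}`, because the relations
hold there. In both cases there are elements `w r i j` of `A`, `r ≥ 0`, `1 ≤ i, j ≤ n`, which go to
`x ^ r Q E_{ij}`. The elements `∂ ^ s x ^ r Q E_{ij}` form a basis of `Cend_{n,Q}`, so the map is an
isomorphism as soon as the `w r i j` span `A` over `k[∂]` (`isPresentedBy_of_delSpan`). For the
latter it is enough that their span over `k[∂]` contains the generators and is stable under left
multiplications by the generators (`delSpan_eq_top`): by conformal associativity, the elements
whose left multiplications preserve a given `∂`-stable subspace form a conformal subalgebra.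

For the large set of generators, `w r i j` is obtained from `e_{ij}` (or `x_{nj}`) by `r`-fold
multiplication by `x_{ii}` on the left (`powUnit`). The relation
`x_{ij} ∘_0 x_{jj} = x_{ii} ∘_0 x_{ij}` brings a product `x_{ij} ∘_m w r j l` back to elements
`w q i l`, by induction on `r` (`IsMatrixSystem.nProd_x_mem`).

For the small set, let `u_i` be the first column `e_{i1}` (`i < n`), `x_{n1}`, let `v_j` be the first
row `e_{1j}`, and `t = e_{1n} ∘_0 x_{n1}`, which represents `x_{11}`. Every generator is of the
form `u_i`, `v_j` or `u_i ∘_0 v_j`, and `w r i j` is `u_i ∘_0 (t ∘_0 ⋯ (t ∘_0 v_j))`. The coefficients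
of `v_j ∘_λ u_i` lie in the span of `e_{11}` and `t`, so everything reduces to the corner
generated by `e_{11}` and `t`, where `e_{11} ∘_λ t = t + λ e_{11}` and
`t ∘_λ t = t ∘_0 t + λ t` follow from the relations. No bound on the locality of the
generators is used here, which is why every `N ≥ 2` gives the same algebra; `N ≥ 2` is needed only
for the generators of `Cend_{n,Q}` to satisfy the bound.
-/

open Polynomial

noncomputable section

universe u v w

/-! ### Homomorphisms and the universal property -/

section General
variable {k : Type u} [Field k] {C : Type v} [AddCommGroup C] [Module k C] [ConformalOps k C]
  {D : Type w} [AddCommGroup D] [Module k D] [ConformalOps k D]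

/-- The linear map `f` is a homomorphism of conformal algebras. -/
structure IsConfHom (f : C →ₗ[k] D) : Prop where
  map_del : ∀ a : C, f (del k a) = del k (f a)
  map_nProd : ∀ (m : ℕ) (a b : C), f (nProd k m a b) = nProd k m (f a) (f b)

/-- The kernel of a homomorphism, as an ideal. -/
def IsConfHom.ker {f : C →ₗ[k] D} (hf : IsConfHom f) : ConfIdeal k C where
  toSubmodule := LinearMap.ker f
  del_mem a ha := by
    change f (del k a) = 0
    rw [hf.map_del, show f a = 0 from ha]
    exact map_zero _
  nProd_mem_left m a b hb := by
    change f (nProd k m a b) = 0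
    rw [hf.map_nProd, show f b = 0 from hb]
    exact map_zero _
  nProd_mem_right m a b ha := by
    change f (nProd k m a b) = 0
    rw [hf.map_nProd, show f a = 0 from ha, nProd, map_zero, LinearMap.zero_apply]

/-- The preimage of a conformal subalgebra under a homomorphism. -/
def IsConfHom.comap {f : C →ₗ[k] D} (hf : IsConfHom f) (U : ConfSubalgebra k D) :
    ConfSubalgebra k C where
  toSubmodule := U.toSubmodule.comap f
  del_mem a ha := by
    change f (del k a) ∈ U.toSubmodule
    rw [hf.map_del]
    exact U.del_mem _ ha
  nProd_mem m a b ha hb := by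
    change f (nProd k m a b) ∈ U.toSubmodule
    rw [hf.map_nProd]
    exact U.nProd_mem m _ _ ha hb

theorem IsConfHom.comp {E : Type*} [AddCommGroup E] [Module k E] [ConformalOps k E]
    {g : D →ₗ[k] E} {f : C →ₗ[k] D} (hg : IsConfHom g) (hf : IsConfHom f) :
    IsConfHom (g ∘ₗ f) where
  map_del a := by simp only [LinearMap.comp_apply, hf.map_del, hg.map_del]
  map_nProd m a b := by simp only [LinearMap.comp_apply, hf.map_nProd, hg.map_nProd]

theorem isConfHom_mkQ (I : ConfIdeal k C) : IsConfHom I.toSubmodule.mkQ where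
  map_del _ := rfl
  map_nProd _ _ _ := rfl

theorem IsConfHom.generates {X : Type*} {f : C →ₗ[k] D} (hf : IsConfHom f)
    (hsurj : Function.Surjective f) {g : X → C} (hg : Generates k g) :
    Generates k (fun x => f (g x)) := by
  intro U hU a
  obtain ⟨b, rfl⟩ := hsurj a
  exact hg (hf.comap U) hU b

/-- A homomorphism vanishing on `S` factors through the quotient by the ideal generated
by `S`. -/
theorem IsConfHom.exists_lift_span {f : C →ₗ[k] D} (hf : IsConfHom f) (S : Set C)
    (hS : ∀ a ∈ S, f a = 0) :
    ∃ φ : (ConfIdeal.span (k := k) S).Quo →ₗ[k] D,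
      IsConfHom φ ∧ ∀ a, φ ((ConfIdeal.span (k := k) S).toQuo a) = f a := by
  have hle : (ConfIdeal.span (k := k) S).toSubmodule ≤ LinearMap.ker f := by
    intro a ha
    simp only [ConfIdeal.span, Submodule.mem_iInf] at ha
    exact ha hf.ker hS
  have hφ : ∀ a, (ConfIdeal.span (k := k) S).toSubmodule.liftQ f hle
      ((ConfIdeal.span (k := k) S).toQuo a) = f a := fun a => by simp [ConfIdeal.toQuo]
  refine ⟨_, ⟨fun a => ?_, fun m a b => ?_⟩, hφ⟩
  · obtain ⟨a, rfl⟩ := (ConfIdeal.span (k := k) S).toSubmodule.mkQ_surjective a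
    rw [ConfIdeal.mk_del, hφ, hφ, hf.map_del]
  · obtain ⟨a, rfl⟩ := (ConfIdeal.span (k := k) S).toSubmodule.mkQ_surjective a
    obtain ⟨b, rfl⟩ := (ConfIdeal.span (k := k) S).toSubmodule.mkQ_surjective b
    rw [ConfIdeal.mk_nProd, hφ, hφ, hφ, hf.map_nProd]

/-- The value of a word at a family of elements of a conformal algebra. -/
def ConfWord.eval (k : Type u) [Field k] {D : Type w} [AddCommGroup D] [Module k D]
    [ConformalOps k D] {X : Type v} (g : X → D) : ConfWord X → D
  | .of x => g x
  | .del a => _root_.del k (a.eval k g)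
  | .nProd m a b => _root_.nProd k m (a.eval k g) (b.eval k g)

theorem isConfHom_linearCombination_eval {X : Type v} (g : X → D) :
    IsConfHom (C := ConfTerm k X) (Finsupp.linearCombination k (ConfWord.eval k g)) where
  map_del a := by
    induction a using Finsupp.induction_linear with
    | zero => simp [del]
    | add a b ha hb => simp only [del, map_add] at ha hb ⊢; rw [ha, hb]
    | single v r => simp [del, ConformalOps.del, ConfWord.eval]
  map_nProd m a b := by
    induction a using Finsupp.induction_linear with
    | zero => simp [nProd]
    | add a a' ha ha' =>
      simp only [nProd, map_add, LinearMap.add_apply] at ha ha' ⊢; rw [ha, ha']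
    | single v r =>
      induction b using Finsupp.induction_linear with
      | zero => simp [nProd]
      | add b b' hb hb' => simp only [nProd, map_add] at hb hb' ⊢; rw [hb, hb']
      | single v' r' =>
        simp only [nProd, ConformalOps.nProd, Finsupp.linearCombination_single,
          LinearMap.smul_apply, Finsupp.lmapDomain_apply, Finsupp.mapDomain_single,
          Finsupp.smul_single, smul_eq_mul, map_smul, ConfWord.eval, smul_smul, mul_comm]

/-- The universal property of the free associative conformal algebra. -/
theorem exists_confHom_confAs [IsAssocConformal k D] {X : Type v} {N : ℕ} (g : X → D)
    (hloc : ∀ (x y : X) (m : ℕ), N ≤ m → nProd k m (g x) (g y) = 0) :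
    ∃ f : ConfAs k X N →ₗ[k] D, IsConfHom f ∧ ∀ x, f (ConfAs.of k N x) = g x := by
  have hE := isConfHom_linearCombination_eval (k := k) g
  have hs : ∀ x : X, Finsupp.linearCombination k (ConfWord.eval k g)
      (Finsupp.single (.of x) 1) = g x := fun x => by simp [ConfWord.eval]
  obtain ⟨f, hf, hf'⟩ := hE.exists_lift_span {a | ConfAxiom k X N a} (by
    rintro a (⟨m, a, b⟩ | ⟨m, a, b⟩ | ⟨n, m, a, b, c⟩ | ⟨x, y, m, hm⟩)
    · rw [map_sub, map_neg, map_smul, sub_eq_zero, hE.map_nProd, hE.map_nProd, hE.map_del]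
      exact IsAssocConformal.del_nProd m _ _
    · rw [map_sub, map_add, map_smul, sub_eq_zero, hE.map_nProd, hE.map_del, hE.map_del,
        hE.map_nProd, hE.map_nProd]
      exact IsAssocConformal.nProd_del m _ _
    · rw [map_sub, map_sum, sub_eq_zero, hE.map_nProd, hE.map_nProd,
        IsAssocConformal.assoc (k := k) n m]
      refine Finset.sum_congr rfl fun s _ => ?_
      rw [map_smul, hE.map_nProd, hE.map_nProd]
    · rw [hE.map_nProd, hs, hs]
      exact hloc x y m hm)
  exact ⟨f, hf, fun x => (hf' _).trans (hs x)⟩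

theorem generates_confAs (X : Type v) (N : ℕ) : Generates k (ConfAs.of k (X := X) N) := by
  intro U hU a
  obtain ⟨a, rfl⟩ := (confAxiomIdeal k X N).toSubmodule.mkQ_surjective a
  have hword : ∀ v : ConfWord X,
      (confAxiomIdeal k X N).toQuo (Finsupp.single v 1) ∈ U.toSubmodule := by
    intro v
    induction v with
    | of x => exact hU x
    | del v ih => simpa [ConfIdeal.mk_del, del, ConformalOps.del] using U.del_mem _ ih
    | nProd m v v' ih ih' =>
      have h := U.nProd_mem m _ _ ih ih'
      rw [ConfIdeal.mk_nProd] at h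
      simpa [nProd, ConformalOps.nProd] using h
  induction a using Finsupp.induction_linear with
  | zero => rw [map_zero]; exact U.toSubmodule.zero_mem
  | add a b ha hb => rw [map_add]; exact U.toSubmodule.add_mem ha hb
  | single v r =>
    have h := U.toSubmodule.smul_mem r (hword v)
    rwa [ConfIdeal.toQuo, ← map_smul, Finsupp.smul_single, smul_eq_mul, mul_one] at h

theorem generates_confAsRel {X : Type v} {N : ℕ} (R : ConfAs k X N → ConfAs k X N → Prop) :
    Generates k (fun x => (relIdeal R).toQuo (ConfAs.of k N x)) :=
  (isConfHom_mkQ (relIdeal R)).generates (Submodule.mkQ_surjective _) (generates_confAs X N)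

theorem toQuo_eq_of_rel {X : Type v} {N : ℕ} {R : ConfAs k X N → ConfAs k X N → Prop}
    {a b : ConfAs k X N} (h : R a b) : (relIdeal R).toQuo a = (relIdeal R).toQuo b :=
  (Submodule.Quotient.eq _).2 (ConfIdeal.subset_span _ ⟨a, b, h, rfl⟩)

/-! ### Spanning an associative conformal algebra over `k[∂]` -/

/-- The `k[∂]`-submodule generated by a family: the intersection of the `∂`-stable subspaces
containing it. -/
def delSpan (k : Type u) [Field k] {C : Type v} [AddCommGroup C] [Module k C] [ConformalOps k C]
    {ι : Type*} (F : ι → C) : Submodule k C :=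
  ⨅ (V : Submodule k C) (_ : (∀ i, F i ∈ V) ∧ ∀ a ∈ V, del k a ∈ V), V

variable {ι : Type*} {F : ι → C}

theorem mem_delSpan (F : ι → C) (i : ι) : F i ∈ delSpan k F := by
  simp only [delSpan, Submodule.mem_iInf]
  exact fun V hV => hV.1 i

theorem del_mem_delSpan {a : C} (ha : a ∈ delSpan k F) : del k a ∈ delSpan k F := by
  simp only [delSpan, Submodule.mem_iInf] at ha ⊢
  exact fun V hV => hV.2 _ (ha V hV)

theorem delSpan_le {V : Submodule k C} (hF : ∀ i, F i ∈ V) (hdel : ∀ a ∈ V, del k a ∈ V) :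
    delSpan k F ≤ V := by
  intro a ha
  simp only [delSpan, Submodule.mem_iInf] at ha
  exact ha V ⟨hF, hdel⟩

theorem nProd_mem_delSpan [IsAssocConformal k C] {c : C}
    (hc : ∀ m i, nProd k m c (F i) ∈ delSpan k F) (m : ℕ) {a : C} (ha : a ∈ delSpan k F) :
    nProd k m c a ∈ delSpan k F := by
  have hle : delSpan k F ≤ ⨅ m, (delSpan k F).comap (ConformalOps.nProd m c) := by
    refine delSpan_le (fun i => ?_) (fun a ha => ?_)
    · simp only [Submodule.mem_iInf]
      exact fun m => hc m i
    · simp only [Submodule.mem_iInf, Submodule.mem_comap] at ha ⊢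
      intro m
      change nProd k m c (del k a) ∈ _
      rw [IsAssocConformal.nProd_del]
      exact add_mem (del_mem_delSpan (ha m)) (Submodule.smul_mem _ _ (ha (m - 1)))
  have h := hle ha
  simp only [Submodule.mem_iInf] at h
  exact h m

/-- A subspace stable under left multiplications by `a` and by `b` is stable under left
multiplications by `a ∘_n b`: conformal associativity expresses `(a ∘_n b) ∘_m c` through
`a ∘_n (b ∘_m c)` and the elements `(a ∘_p b) ∘_q c` with `p < n`. -/
theorem nProd_nProd_mem [IsAssocConformal k C] {V : Submodule k C} {a b : C}
    (ha : ∀ m, ∀ c ∈ V, nProd k m a c ∈ V) (hb : ∀ m, ∀ c ∈ V, nProd k m b c ∈ V)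
    (n m : ℕ) {c : C} (hc : c ∈ V) : nProd k m (nProd k n a b) c ∈ V := by
  induction n using Nat.strong_induction_on generalizing m with
  | _ n ih =>
    have h := IsAssocConformal.assoc (k := k) n m a b c
    rw [Finset.sum_range_succ'] at h
    have h0 : nProd k m (nProd k n a b) c = nProd k n a (nProd k m b c) -
        ∑ s ∈ Finset.range n, (n.choose (s + 1) : k) •
          nProd k (m + (s + 1)) (nProd k (n - (s + 1)) a b) c := by
      rw [h]; simp
    rw [h0]
    refine sub_mem (ha n _ (hb m c hc)) (sum_mem fun s hs => Submodule.smul_mem _ _ ?_)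
    rw [Finset.mem_range] at hs
    exact ih _ (by omega) _

/-- A family of elements spans over `k[∂]` as soon as its span contains the generators and
is stable under left multiplications by the generators. -/
theorem delSpan_eq_top [IsAssocConformal k C] {X : Type*} {g : X → C} (hg : Generates k g)
    (hmem : ∀ x, g x ∈ delSpan k F)
    (hmul : ∀ x m i, nProd k m (g x) (F i) ∈ delSpan k F) : delSpan k F = ⊤ := by
  -- The elements whose left multiplications preserve the span form a conformal subalgebra.
  let L : ConfSubalgebra k C :=
    { carrier := {a | ∀ m, ∀ b ∈ delSpan k F, nProd k m a b ∈ delSpan k F}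
      zero_mem' := fun m b _ => by simp [nProd]
      add_mem' := fun {a a'} ha ha' m b hb => by
        rw [nProd, map_add, LinearMap.add_apply]
        exact add_mem (ha m b hb) (ha' m b hb)
      smul_mem' := fun r a ha m b hb => by
        rw [nProd, map_smul, LinearMap.smul_apply]
        exact Submodule.smul_mem _ _ (ha m b hb)
      del_mem := fun a ha m b hb => by
        rw [IsAssocConformal.del_nProd]
        exact neg_mem (Submodule.smul_mem _ _ (ha (m - 1) b hb))
      nProd_mem := fun n a b ha hb m c hc => nProd_nProd_mem ha hb n m hc }
  have hL : ∀ a : C, ∀ m, ∀ b ∈ delSpan k F, nProd k m a b ∈ delSpan k F :=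
    hg L fun x m b hb => nProd_mem_delSpan (hmul x) m hb
  let V : ConfSubalgebra k C :=
    { delSpan k F with
      del_mem := fun a ha => del_mem_delSpan ha
      nProd_mem := fun m a b _ hb => hL a m b hb }
  exact eq_top_iff.2 fun a _ => hg V hmem a

end General

/-! ### The normal form in `Cend_{n,Q}` -/

section Cend
variable {k : Type u} [Field k] {n : ℕ}

/-- The `i`-th diagonal entry of `diag(1, …, 1, x)`. -/
def diagEntry (k : Type u) [Field k] {n : ℕ} (i : Fin n) : k[X] := if i.val + 1 = n then X else 1

theorem diagEntry_ne_zero (i : Fin n) : diagEntry k i ≠ 0 := by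
  rw [diagEntry]
  split_ifs
  exacts [X_ne_zero, one_ne_zero]

theorem diagQ_map_mul_apply (B : Cend k n) (i j : Fin n) :
    ((diagQ k n).map (PolyDX.ofX k) * B) i j = PolyDX.ofX k (diagEntry k i) * B i j := by
  have h : (diagQ k n).map (PolyDX.ofX k) =
      Matrix.diagonal fun i => PolyDX.ofX k (diagEntry k i) := by
    rw [diagQ, Matrix.diagonal_map (map_zero _)]
    rfl
  rw [h, Matrix.diagonal_mul]

theorem ofX_injective : Function.Injective (PolyDX.ofX k) := C_injective

theorem diagQ_map_mul_injective {A B : Cend k n}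
    (h : (diagQ k n).map (PolyDX.ofX k) * A = (diagQ k n).map (PolyDX.ofX k) * B) : A = B := by
  have : IsDomain (PolyDX k) := inferInstanceAs (IsDomain k[X][X])
  ext1 i j
  have h1 := congrFun (congrFun h i) j
  rw [diagQ_map_mul_apply, diagQ_map_mul_apply] at h1
  exact mul_left_cancel₀ ((map_ne_zero_iff _ ofX_injective).2 (diagEntry_ne_zero i)) h1

variable {A : Type v} [AddCommGroup A] [Module k A] [ConformalOps k A]

/-- The linear map `k[∂, x] → A` with `∂ ^ s x ^ r ↦ ∂ ^ s (w r)`. -/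
def polyLift (w : ℕ → A) : PolyDX k →ₗ[k] A :=
  (Polynomial.lsum fun s => (ConformalOps.del (k := k) (C := A) ^ s) ∘ₗ
    Polynomial.lsum fun r => LinearMap.toSpanSingleton k A (w r) : k[X][X] →ₗ[k] A)

theorem polyLift_ofX (w : ℕ → A) (f : k[X]) :
    polyLift w (PolyDX.ofX k f) =
      Polynomial.lsum (fun r => LinearMap.toSpanSingleton k A (w r)) f := by
  change Polynomial.lsum _ (C f : k[X][X]) = _
  rw [lsum_apply, sum_C_index]
  · simp
  · simp

theorem polyLift_ofX_X_pow (w : ℕ → A) (r : ℕ) : polyLift w (PolyDX.ofX k (X ^ r)) = w r := by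
  rw [polyLift_ofX, lsum_apply, ← monomial_one_right_eq_X_pow, sum_monomial_index]
  · simp
  · simp

theorem polyLift_pd_mul (w : ℕ → A) (a : PolyDX k) :
    polyLift w (PolyDX.pd k * a) = del k (polyLift w a) := by
  have h : ∀ p : k[X][X], polyLift w (X * p : k[X][X]) = del k (polyLift w p) := by
    intro p
    induction p using Polynomial.induction_on' with
    | add p q hp hq =>
      rw [mul_add]
      refine (map_add (polyLift w) _ _).trans ?_
      rw [hp, hq]
      refine Eq.trans ?_ (congrArg (del k) (map_add (polyLift w) _ _)).symm
      rw [del, del, del, map_add]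
    | monomial s f =>
      rw [X_mul_monomial]
      change Polynomial.lsum _ (monomial (s + 1) f) = del k (Polynomial.lsum _ (monomial s f))
      rw [lsum_apply, lsum_apply, sum_monomial_index, sum_monomial_index]
      · rw [pow_succ']
        rfl
      · simp
      · simp
  exact h a

/-- The linear map `M_n(k[∂, x]) → A` with `∂ ^ s x ^ r E_{ij} ↦ ∂ ^ s (w r i j)`. -/
def matLift (w : ℕ → Fin n → Fin n → A) : Cend k n →ₗ[k] A :=
  ∑ i, ∑ j, polyLift (fun r => w r i j) ∘ₗ Matrix.entryLinearMap k (PolyDX k) i j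

theorem matLift_apply (w : ℕ → Fin n → Fin n → A) (B : Cend k n) :
    matLift w B = ∑ i, ∑ j, polyLift (fun r => w r i j) (B i j) := by
  simp only [matLift, LinearMap.sum_apply]
  rfl

theorem matLift_del (w : ℕ → Fin n → Fin n → A) (B : Cend k n) :
    matLift w (del k B) = del k (matLift w B) := by
  simp only [matLift_apply, Cend.del_apply, polyLift_pd_mul, del, map_sum]

theorem matLift_single (w : ℕ → Fin n → Fin n → A) (i j : Fin n) (a : PolyDX k) :
    matLift w (Matrix.single i j a) = polyLift (fun r => w r i j) a := by
  rw [matLift_apply, Finset.sum_eq_single i, Finset.sum_eq_single j]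
  · simp
  · intro b _ hb; simp [hb.symm]
  · simp
  · intro b _ hb; simp [hb.symm]
  · simp

theorem del_single (i j : Fin n) (a : PolyDX k) :
    del k (Matrix.single i j a : Cend k n) = Matrix.single i j (PolyDX.pd k * a) := by
  ext1 p q
  rw [Cend.del_apply]
  simp [Matrix.single_apply]

/-- A homomorphism taking `w r i j` to `x ^ r Q E_{ij}` takes the element of `A` with
coordinates `B` to the matrix `Q B`. -/
theorem map_matLift {f : A →ₗ[k] Cend k n} (hf : IsConfHom f) (w : ℕ → Fin n → Fin n → A)
    (hw : ∀ r i j, f (w r i j) =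
      Matrix.single i j (PolyDX.ofX k (diagEntry k i) * PolyDX.ofX k (X ^ r))) (B : Cend k n) :
    f (matLift w B) = (diagQ k n).map (PolyDX.ofX k) * B := by
  have hpoly : ∀ i j (a : PolyDX k), f (polyLift (fun r => w r i j) a) =
      Matrix.single i j (PolyDX.ofX k (diagEntry k i) * a) := by
    intro i j a
    induction a using PolyDX.induction with
    | hof p =>
      induction p using Polynomial.induction_on' with
      | add p q hp hq => simp only [map_add, hp, hq, mul_add, Matrix.single_add]
      | monomial r c =>
        rw [← mul_one c, ← smul_eq_mul, ← smul_monomial, monomial_one_right_eq_X_pow, map_smul,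
          map_smul, map_smul, polyLift_ofX_X_pow, hw, mul_smul_comm, Matrix.smul_single]
    | hadd a b ha hb => simp only [map_add, ha, hb, mul_add, Matrix.single_add]
    | hd a ih => rw [polyLift_pd_mul, hf.map_del, ih, del_single, mul_left_comm]
  rw [matLift_apply, map_sum]
  simp only [map_sum, hpoly]
  refine Eq.trans ?_ (Matrix.matrix_eq_sum_single _).symm
  simp only [diagQ_map_mul_apply]

/-- The normal form criterion: a family `g` presents `Cend_{n,Q}` if the relations hold, and the
algebra they define is spanned over `k[∂]` by elements `w r i j` corresponding to
`x ^ r Q E_{ij}`. -/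
theorem isPresentedBy_of_delSpan {X : Type v} {N : ℕ} (g : X → (CendQ (diagQ k n)).Elem)
    (R : ConfAs k X N → ConfAs k X N → Prop)
    (hloc : ∀ (x y : X) (m : ℕ), N ≤ m → nProd k m (g x) (g y) = 0)
    (hR : ∀ f : ConfAs k X N →ₗ[k] Cend k n, IsConfHom f →
      (∀ x, f (ConfAs.of k N x) = (g x).1) → ∀ a b, R a b → f a = f b)
    (w : ℕ → Fin n → Fin n → ConfAsRel R)
    (hw : ∀ f : ConfAsRel R →ₗ[k] Cend k n, IsConfHom f →
      (∀ x, f ((relIdeal R).toQuo (ConfAs.of k N x)) = (g x).1) → ∀ r i j, f (w r i j) =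
        Matrix.single i j (PolyDX.ofX k (diagEntry k i) * PolyDX.ofX k (Polynomial.X ^ r)))
    (hspan : delSpan k (fun p : ℕ × Fin n × Fin n => w p.1 p.2.1 p.2.2) = ⊤) :
    IsPresentedBy g N R := by
  have hsub : IsConfHom (CendQ (diagQ k n)).toSubmodule.subtype :=
    ⟨fun _ => rfl, fun _ _ _ => rfl⟩
  obtain ⟨f, hf, hfg⟩ := exists_confHom_confAs g hloc
  have hfR : ∀ a b, R a b → f a = f b := fun a b h =>
    Subtype.ext (hR _ (hsub.comp hf) (fun x => congrArg Subtype.val (hfg x)) a b h)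
  obtain ⟨φ, hφ, hφf⟩ := hf.exists_lift_span {c | ∃ a b, R a b ∧ c = a - b} (by
    rintro _ ⟨a, b, h, rfl⟩
    rw [map_sub, hfR a b h, sub_self])
  have hφg : ∀ x, φ ((relIdeal R).toQuo (ConfAs.of k N x)) = g x := fun x =>
    (hφf _).trans (hfg x)
  have hQ : ∀ B, (φ (matLift w B)).1 = (diagQ k n).map (PolyDX.ofX k) * B :=
    map_matLift (hsub.comp hφ) w
      (hw _ (hsub.comp hφ) fun x => congrArg Subtype.val (hφg x))
  -- `matLift w` is onto because its image is `∂`-stable and contains all `w r i j`.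
  have hσ : Function.Surjective (matLift (k := k) w) := by
    rw [← LinearMap.range_eq_top, eq_top_iff, ← hspan]
    refine delSpan_le
      (fun p => ⟨Matrix.single p.2.1 p.2.2 (PolyDX.ofX k (Polynomial.X ^ p.1)), ?_⟩) ?_
    · rw [matLift_single, polyLift_ofX_X_pow]
    · rintro _ ⟨B, rfl⟩
      exact ⟨del k B, matLift_del w B⟩
  -- The composition `φ ∘ matLift w` is multiplication by `Q`, a bijection onto `Cend_{n,Q}`.
  have hinj : Function.Injective φ := by
    intro a b h
    obtain ⟨A, rfl⟩ := hσ a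
    obtain ⟨B, rfl⟩ := hσ b
    rw [diagQ_map_mul_injective ((hQ A).symm.trans ((congrArg Subtype.val h).trans (hQ B)))]
  have hsurj : Function.Surjective φ := by
    rintro ⟨_, B, rfl⟩
    exact ⟨matLift w B, Subtype.ext (hQ B)⟩
  refine ⟨?_, ⟨LinearEquiv.ofBijective φ ⟨hinj, hsurj⟩, hφ.map_del, hφ.map_nProd⟩, hφg⟩
  have h := hφ.generates hsurj (generates_confAsRel R)
  simpa only [hφg] using h

/-! ### Products of matrix units -/

theorem nProd_single (m : ℕ) (i j p l : Fin n) (a b : PolyDX k) :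
    nProd k m (Matrix.single i j a : Cend k n) (Matrix.single p l b) =
      if j = p then Matrix.single i l (PolyDX.scProd k m a b) else 0 := by
  ext1 c d
  rw [Cend.nProd_apply, Finset.sum_eq_single j]
  · by_cases hc : i = c <;> by_cases hd : l = d <;> by_cases hj : j = p <;>
      simp [hc, hd, hj, eq_comm]
  · intro b _ hb; simp [Matrix.single_apply, hb.symm]
  · simp

theorem scProd_zero_ofX (f : k[X]) (b : PolyDX k) :
    PolyDX.scProd k 0 (PolyDX.ofX k f) b = PolyDX.ofX k f * b := by
  rw [PolyDX.scProd_ofX, PolyDX.taylorOp, PolyDX.substR_coeff_zero]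
  simp

theorem scProd_ofX_one (m : ℕ) (f : k[X]) :
    PolyDX.scProd k m (PolyDX.ofX k f) 1 = lamPoly (PolyDX.ofX k f) 0 m := by
  rw [PolyDX.scProd_ofX, PolyDX.taylorOp, map_one]
  rcases m with _ | _ | m <;> simp [lamPoly, coeff_one]

theorem scProd_ofX_px (m : ℕ) (f : k[X]) :
    PolyDX.scProd k m (PolyDX.ofX k f) (PolyDX.px k) =
      lamPoly (PolyDX.ofX k f * PolyDX.px k) (PolyDX.ofX k f) m := by
  rw [PolyDX.scProd_ofX, PolyDX.taylorOp, PolyDX.substR, PolyDX.subst_px]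
  rcases m with _ | _ | m <;> simp [lamPoly, coeff_X, coeff_C]

theorem scProd_one_one (m : ℕ) : PolyDX.scProd k m 1 1 = lamPoly 1 0 m := by
  simpa using scProd_ofX_one (k := k) m 1

theorem scProd_px_one (m : ℕ) :
    PolyDX.scProd k m (PolyDX.px k) 1 = lamPoly (PolyDX.px k) 0 m :=
  scProd_ofX_one m X

theorem scProd_one_px (m : ℕ) :
    PolyDX.scProd k m 1 (PolyDX.px k) = lamPoly (PolyDX.px k) 1 m := by
  simpa using scProd_ofX_px (k := k) m 1

theorem scProd_px_px (m : ℕ) : PolyDX.scProd k m (PolyDX.px k) (PolyDX.px k) =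
    lamPoly (PolyDX.px k * PolyDX.px k) (PolyDX.px k) m :=
  scProd_ofX_px m X

/-- Matrices of degree at most one in `x` and zero in `∂` have locality bound `2`. -/
theorem nProd_toMatrix_of_two_le (a b : Gen n) {m : ℕ} (hm : 2 ≤ m) :
    nProd k m (a.toMatrix k) (b.toMatrix k) = 0 := by
  obtain ⟨m, rfl⟩ := Nat.exists_eq_add_of_le' hm
  rcases a with ⟨i, j, hi⟩ | ⟨i, j⟩ <;> rcases b with ⟨p, l, hp⟩ | ⟨p, l⟩ <;>
    simp only [Gen.toMatrix, nProd_single, scProd_one_one, scProd_px_one, scProd_one_px,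
      scProd_px_px, lamPoly, Matrix.single_zero, ite_self]

end Cend

/-! ### Rewriting products -/

section Products
variable {k : Type u} [Field k] {A : Type v} [AddCommGroup A] [Module k A] [ConformalOps k A]

theorem zero_nProd (m : ℕ) (a : A) : nProd k m 0 a = 0 := by
  rw [nProd, map_zero, LinearMap.zero_apply]

theorem nProd_zero (m : ℕ) (a : A) : nProd k m a 0 = 0 := map_zero _

theorem nProd_zero_nProd [IsAssocConformal k A] (m : ℕ) (a b c : A) :
    nProd k 0 a (nProd k m b c) = nProd k m (nProd k 0 a b) c := by
  simpa using IsAssocConformal.assoc (k := k) 0 m a b c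

/-- Conformal associativity moves the parentheses of `a ∘_m (b ∘_p c)` to the left. -/
theorem nProd_nProd_mem_of_left [IsAssocConformal k A] {V : Submodule k A} {a b c : A}
    (h : ∀ q s, nProd k s (nProd k q a b) c ∈ V) (m p : ℕ) :
    nProd k m a (nProd k p b c) ∈ V := by
  rw [IsAssocConformal.assoc]
  exact sum_mem fun s _ => Submodule.smul_mem _ _ (h _ _)

/-- If `a ∘_q b = 0` for all `q > 0`, then `a ∘_m (b ∘_0 c) = (a ∘_0 b) ∘_m c`. -/
theorem nProd_nProd_zero_of_const [IsAssocConformal k A] {a b : A}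
    (h : ∀ q, nProd k (q + 1) a b = 0) (m : ℕ) (c : A) :
    nProd k m a (nProd k 0 b c) = nProd k m (nProd k 0 a b) c := by
  rw [IsAssocConformal.assoc, Finset.sum_range_succ, Finset.sum_eq_zero]
  · simp
  · intro s hs
    rw [Finset.mem_range] at hs
    obtain ⟨q, hq⟩ := Nat.exists_eq_succ_of_ne_zero (show m - s ≠ 0 by omega)
    rw [hq, h q, zero_nProd, smul_zero]

theorem apply_mem_span_range {A : Type v} [AddCommGroup A] [Module k A] {F : ℕ → A}
    {V : Submodule k A} (T : A →ₗ[k] A) (hF : ∀ r, T (F r) ∈ V) {a : A}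
    (ha : a ∈ Submodule.span k (Set.range F)) : T a ∈ V := by
  have hle : Submodule.span k (Set.range F) ≤ V.comap T :=
    Submodule.span_le.2 (Set.range_subset_iff.2 hF)
  exact hle ha

theorem map_lamPoly {A : Type v} [AddCommGroup A] [Module k A] {B : Type*} [AddCommGroup B]
    [Module k B] (f : A →ₗ[k] B) (a b : A) (m : ℕ) :
    f (lamPoly a b m) = lamPoly (f a) (f b) m := by
  rcases m with _ | _ | m <;> simp [lamPoly]

end Products

/-! ### The algebra generated by all `e_{ij}` and `x_{ij}` -/

section MatrixSystem
variable {k : Type u} [Field k] {n : ℕ} {A : Type v} [AddCommGroup A] [Module k A]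
  [ConformalOps k A]

/-- The relations between `e_{ij}` (`i < n`) and `x_{ij}` in an algebra, with the
locality `x_{ij} ∘_m x_{jl} = 0` for `m ≥ 2` included. -/
structure IsMatrixSystem (k : Type u) [Field k] {n : ℕ} {A : Type v} [AddCommGroup A] [Module k A]
    [ConformalOps k A] (e : ∀ i : Fin n, Fin n → i.val + 1 < n → A) (x : Fin n → Fin n → A) :
    Prop where
  xe (i j p l : Fin n) (hp : p.val + 1 < n) (m : ℕ) :
    nProd k m (x i j) (e p l hp) = lamPoly (if j = p then x i l else 0) 0 m
  ee (i j p l : Fin n) (hi : i.val + 1 < n) (hp : p.val + 1 < n) (m : ℕ) :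
    nProd k m (e i j hi) (e p l hp) = lamPoly (if j = p then e i l hi else 0) 0 m
  ex (i j p l : Fin n) (hi : i.val + 1 < n) (m : ℕ) : nProd k m (e i j hi) (x p l) =
    lamPoly (if j = p then x i l else 0) (if j = p then e i l hi else 0) m
  xx_one (i j l : Fin n) : nProd k 1 (x i j) (x j l) = x i l
  xx_ne (i j p l : Fin n) (hjp : j ≠ p) (m : ℕ) : nProd k m (x i j) (x p l) = 0
  xx_zero (i j p l : Fin n) : nProd k 0 (x i j) (x j l) = nProd k 0 (x i p) (x p l)
  xx_local (i j p l : Fin n) (m : ℕ) : nProd k (m + 2) (x i j) (x p l) = 0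

/-- The element representing `x ^ r Q E_{ij}`, where `Q E_{ij}` is `e_{ij}` if `i < n` and `x_{nj}`
if `i = n`: the iterated product `x_{ii} ∘_0 (x_{ii} ∘_0 ⋯)`. -/
def powUnit (k : Type u) [Field k] {n : ℕ} {A : Type v} [AddCommGroup A] [Module k A]
    [ConformalOps k A] (e : ∀ i : Fin n, Fin n → i.val + 1 < n → A) (x : Fin n → Fin n → A) :
    ℕ → Fin n → Fin n → A
  | 0, i, j => if h : i.val + 1 < n then e i j h else x i j
  | r + 1, i, j => nProd k 0 (x i i) (powUnit k e x r i j)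

/-- The span of the elements representing `x ^ r Q E_{ij}` for fixed `i`, `j`. -/
def powSpan (k : Type u) [Field k] {n : ℕ} {A : Type v} [AddCommGroup A] [Module k A]
    [ConformalOps k A] (e : ∀ i : Fin n, Fin n → i.val + 1 < n → A) (x : Fin n → Fin n → A)
    (i j : Fin n) : Submodule k A :=
  Submodule.span k (Set.range fun r => powUnit k e x r i j)

variable {e : ∀ i : Fin n, Fin n → i.val + 1 < n → A} {x : Fin n → Fin n → A}

theorem powUnit_mem_powSpan (r : ℕ) (i j : Fin n) : powUnit k e x r i j ∈ powSpan k e x i j :=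
  Submodule.subset_span ⟨r, rfl⟩

theorem e_mem_powSpan (i j : Fin n) (hi : i.val + 1 < n) : e i j hi ∈ powSpan k e x i j := by
  have h := powUnit_mem_powSpan (k := k) (e := e) (x := x) 0 i j
  rwa [powUnit, dif_pos hi] at h

theorem nProd_x_self_mem_powSpan {i j : Fin n} {a : A} (ha : a ∈ powSpan k e x i j) :
    nProd k 0 (x i i) a ∈ powSpan k e x i j :=
  apply_mem_span_range (ConformalOps.nProd 0 (x i i))
    (fun r => powUnit_mem_powSpan (r + 1) i j) ha

namespace IsMatrixSystem

theorem x_mem_powSpan (h : IsMatrixSystem k e x) (i j : Fin n) : x i j ∈ powSpan k e x i j := by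
  by_cases hi : i.val + 1 < n
  · have h1 := nProd_x_self_mem_powSpan (k := k) (x := x) (e_mem_powSpan (k := k) (e := e) i j hi)
    rwa [h.xe, if_pos rfl] at h1
  · have h1 := powUnit_mem_powSpan (k := k) (e := e) (x := x) 0 i j
    rwa [powUnit, dif_neg hi] at h1

theorem nProd_x_x_mem [IsAssocConformal k A] (h : IsMatrixSystem k e x) (i j p l : Fin n)
    (m : ℕ) : nProd k m (x i j) (x p l) ∈ powSpan k e x i l := by
  by_cases hjp : j = p
  · subst hjp
    rcases m with _ | _ | m
    · rw [h.xx_zero i j i l]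
      exact nProd_x_self_mem_powSpan (h.x_mem_powSpan i l)
    · rw [h.xx_one]
      exact h.x_mem_powSpan i l
    · rw [h.xx_local]
      exact zero_mem _
  · rw [h.xx_ne i j p l hjp]
    exact zero_mem _

/-- Left multiplication by `x_{ij}` preserves normal forms: by induction on the degree, since
the relation `x_{ij} ∘_0 x_{jj} = x_{ii} ∘_0 x_{ij}` moves the factor `x` to the left. -/
theorem nProd_x_mem [IsAssocConformal k A] (h : IsMatrixSystem k e x) (r : ℕ) (i j p l : Fin n)
    (m : ℕ) : nProd k m (x i j) (powUnit k e x r p l) ∈ powSpan k e x i l := by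
  induction r generalizing m with
  | zero =>
    rw [powUnit]
    split_ifs with hp
    · rw [h.xe]
      rcases m with _ | _ | m
      · rw [lamPoly]
        split_ifs
        exacts [h.x_mem_powSpan i l, zero_mem _]
      · exact zero_mem _
      · exact zero_mem _
    · exact h.nProd_x_x_mem i j p l m
  | succ r ih =>
    rw [powUnit]
    refine nProd_nProd_mem_of_left (fun q s => ?_) m 0
    by_cases hjp : j = p
    · subst hjp
      rcases q with _ | _ | q
      · rw [h.xx_zero i j i j, ← nProd_zero_nProd]
        exact nProd_x_self_mem_powSpan (ih s)
      · rw [h.xx_one]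
        exact ih s
      · rw [h.xx_local, zero_nProd]
        exact zero_mem _
    · rw [h.xx_ne i j p p hjp, zero_nProd]
      exact zero_mem _

theorem nProd_e_mem [IsAssocConformal k A] (h : IsMatrixSystem k e x) (r : ℕ) (i j p l : Fin n)
    (hi : i.val + 1 < n) (m : ℕ) :
    nProd k m (e i j hi) (powUnit k e x r p l) ∈ powSpan k e x i l := by
  induction r generalizing m with
  | zero =>
    rw [powUnit]
    split_ifs with hp
    · rw [h.ee]
      rcases m with _ | _ | m
      · rw [lamPoly]
        split_ifs
        exacts [e_mem_powSpan i l hi, zero_mem _]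
      · exact zero_mem _
      · exact zero_mem _
    · rw [h.ex]
      rcases m with _ | _ | m
      · rw [lamPoly]
        split_ifs
        exacts [h.x_mem_powSpan i l, zero_mem _]
      · rw [lamPoly]
        split_ifs
        exacts [e_mem_powSpan i l hi, zero_mem _]
      · exact zero_mem _
  | succ r ih =>
    rw [powUnit]
    refine nProd_nProd_mem_of_left (fun q s => ?_) m 0
    rw [h.ex]
    rcases q with _ | _ | q
    · rw [lamPoly]
      split_ifs with hjp
      · exact h.nProd_x_mem r i p p l s
      · rw [zero_nProd]
        exact zero_mem _
    · rw [lamPoly]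
      split_ifs with hjp
      · rw [← hjp] at ih ⊢
        exact ih s
      · rw [zero_nProd]
        exact zero_mem _
    · rw [lamPoly, zero_nProd]
      exact zero_mem _

theorem delSpan_eq_top [IsAssocConformal k A] (h : IsMatrixSystem k e x) {g : Gen n → A}
    (hg : Generates k g) (he : ∀ i j hi, g (.e i j hi) = e i j hi)
    (hx : ∀ i j, g (.x i j) = x i j) :
    delSpan k (fun p : ℕ × Fin n × Fin n => powUnit k e x p.1 p.2.1 p.2.2) = ⊤ := by
  have hle : ∀ i j, powSpan k e x i j ≤
      delSpan k (fun p : ℕ × Fin n × Fin n => powUnit k e x p.1 p.2.1 p.2.2) := fun i j =>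
    Submodule.span_le.2 (Set.range_subset_iff.2 fun r => mem_delSpan _ (r, i, j))
  refine _root_.delSpan_eq_top hg ?_ ?_
  · rintro (⟨i, j, hi⟩ | ⟨i, j⟩)
    · rw [he]
      exact hle i j (e_mem_powSpan i j hi)
    · rw [hx]
      exact hle i j (h.x_mem_powSpan i j)
  · rintro (⟨i, j, hi⟩ | ⟨i, j⟩) m ⟨r, p, l⟩
    · rw [he]
      exact hle i l (h.nProd_e_mem r i j p l hi m)
    · rw [hx]
      exact hle i l (h.nProd_x_mem r i j p l m)

end IsMatrixSystem

theorem map_powUnit {f : A →ₗ[k] Cend k n} (hf : IsConfHom f)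
    (he : ∀ i j hi, f (e i j hi) = Matrix.single i j 1)
    (hx : ∀ i j, f (x i j) = Matrix.single i j (PolyDX.px k)) (r : ℕ) (i j : Fin n) :
    f (powUnit k e x r i j) =
      Matrix.single i j (PolyDX.ofX k (diagEntry k i) * PolyDX.ofX k (X ^ r)) := by
  induction r with
  | zero =>
    rw [powUnit, diagEntry]
    by_cases hi : i.val + 1 < n
    · rw [dif_pos hi, if_neg hi.ne, he]
      simp
    · rw [dif_neg hi, if_pos (by omega), hx, PolyDX.px]
      simp
  | succ r ih =>
    rw [powUnit, hf.map_nProd, hx, ih, nProd_single, if_pos rfl, PolyDX.px, scProd_zero_ofX,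
      pow_succ', map_mul, mul_left_comm]

end MatrixSystem

/-- The relations hold in `Cend_n`. -/
theorem DefRel.map_eq {k : Type u} [Field k] {n : ℕ}
    {f : ConfAs k (Gen n) 2 →ₗ[k] Cend k n} (hf : IsConfHom f)
    (hfg : ∀ g : Gen n, f (ConfAs.of k 2 g) = g.toMatrix k)
    {a b : ConfAs k (Gen n) 2} (hab : DefRel k n a b) : f a = f b := by
  have he : ∀ i j hi, f (eSym k i j hi) = Matrix.single i j 1 := fun i j hi => hfg _
  have hx : ∀ i j, f (xSym k i j) = Matrix.single i j (PolyDX.px k) := fun i j => hfg _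
  cases hab with
  | ee i j p l hi hp m =>
    rw [hf.map_nProd, map_lamPoly, apply_ite f, he, he, he, nProd_single, scProd_one_one, map_zero]
    rcases m with _ | _ | m <;> simp [lamPoly]
  | xe i j p l hp m =>
    rw [hf.map_nProd, map_lamPoly, apply_ite f, hx, he, hx, nProd_single, scProd_px_one, map_zero]
    rcases m with _ | _ | m <;> simp [lamPoly]
  | ex i j p l hi m =>
    rw [hf.map_nProd, map_lamPoly, apply_ite f, apply_ite f, hx, he, hx, nProd_single,
      scProd_one_px, map_zero]
    rcases m with _ | _ | m <;> simp [lamPoly, he]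
  | xx_one i j l =>
    rw [hf.map_nProd, hx, hx, hx, nProd_single, if_pos rfl, scProd_px_px, lamPoly]
  | xx_ne i j p l hjp m =>
    rw [hf.map_nProd, hx, hx, nProd_single, if_neg hjp, map_zero]
  | xx_zero i j p l =>
    simp only [hf.map_nProd, hx, nProd_single, if_pos]

theorem isPresentedBy_genCendQ (k : Type u) [Field k] (n : ℕ) :
    IsPresentedBy (genCendQ k (n := n)) 2 (DefRel k n) := by
  let E : ∀ i : Fin n, Fin n → i.val + 1 < n → ConfAsRel (DefRel k n) :=
    fun i j hi => (relIdeal (DefRel k n)).toQuo (eSym k i j hi)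
  let Y : Fin n → Fin n → ConfAsRel (DefRel k n) :=
    fun i j => (relIdeal (DefRel k n)).toQuo (xSym k i j)
  have hEY : IsMatrixSystem k E Y :=
    { xe := fun i j p l hp m => by
        refine (toQuo_eq_of_rel (DefRel.xe i j p l hp m)).trans ((map_lamPoly _ _ _ _).trans ?_)
        rw [apply_ite (relIdeal (DefRel k n)).toSubmodule.mkQ, map_zero]
      ee := fun i j p l hi hp m => by
        refine (toQuo_eq_of_rel (DefRel.ee i j p l hi hp m)).trans ((map_lamPoly _ _ _ _).trans ?_)
        rw [apply_ite (relIdeal (DefRel k n)).toSubmodule.mkQ, map_zero]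
      ex := fun i j p l hi m => by
        refine (toQuo_eq_of_rel (DefRel.ex i j p l hi m)).trans ((map_lamPoly _ _ _ _).trans ?_)
        rw [apply_ite (relIdeal (DefRel k n)).toSubmodule.mkQ,
          apply_ite (relIdeal (DefRel k n)).toSubmodule.mkQ, map_zero]
      xx_one := fun i j l => toQuo_eq_of_rel (DefRel.xx_one i j l)
      xx_ne := fun i j p l hjp m =>
        (toQuo_eq_of_rel (DefRel.xx_ne i j p l hjp m)).trans (map_zero _)
      xx_zero := fun i j p l => toQuo_eq_of_rel (DefRel.xx_zero i j p l)
      xx_local := fun i j p l m => by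
        have h : nProd k (m + 2) (xSym k i j) (xSym k p l) = 0 :=
          (Submodule.Quotient.mk_eq_zero _).2
            (ConfIdeal.subset_span _ (.locality _ _ _ (by omega)))
        exact (congrArg (relIdeal (DefRel k n)).toQuo h).trans (map_zero _) }
  refine isPresentedBy_of_delSpan _ _ ?_ ?_ (powUnit k E Y) ?_
    (hEY.delSpan_eq_top (generates_confAsRel _) (fun _ _ _ => rfl) (fun _ _ => rfl))
  · intro a b m hm
    exact Subtype.ext (nProd_toMatrix_of_two_le a b hm)
  · exact fun f hf hfg a b hab => hab.map_eq hf hfg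
  · intro f hf hfg
    exact map_powUnit hf (fun i j hi => hfg _) (fun i j => hfg _)

/-! ### The algebra generated by `e_{ij}` (`i, j < n`), `e_{1n}`, `x_{n1}` -/

section CornerSystem
variable {k : Type u} [Field k] {n : ℕ} {A : Type v} [AddCommGroup A] [Module k A]
  [ConformalOps k A]

/-- The relations between the first column `u_i` and the first row `v_j` of `Cend_{n,Q}`: `u_i`
stands for `e_{i1}` if `i < n` and for `x_{n1}` if `i = n`, `v_j` for `e_{1j}`, and the index
`1` is denoted by `z`. The entry `x_{11}` appears as `v_n ∘_0 u_n`. -/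
structure IsCornerSystem (k : Type u) [Field k] {n : ℕ} {A : Type v} [AddCommGroup A] [Module k A]
    [ConformalOps k A] (z : Fin n) (u v : Fin n → A) : Prop where
  u_first : u z = v z
  u_unit (i : Fin n) : nProd k 0 (u i) (v z) = u i
  unit_v (j : Fin n) (m : ℕ) : nProd k m (v z) (v j) = lamPoly (v j) 0 m
  v_u_ne (p i : Fin n) (hpi : p ≠ i) (m : ℕ) : nProd k m (v p) (u i) = 0
  v_u_lt (p : Fin n) (hp : p.val + 1 < n) (m : ℕ) : nProd k m (v p) (u p) = lamPoly (v z) 0 m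
  v_u_one (p : Fin n) (hp : p.val + 1 = n) : nProd k 1 (v p) (u p) = v z
  v_u_add_two (p : Fin n) (hp : p.val + 1 = n) (m : ℕ) : nProd k (m + 2) (v p) (u p) = 0

/-- The iterated product `t ∘_0 (t ∘_0 ⋯ (t ∘_0 v))`. For `t = x_{11}` and `v = e_{1j}` it
represents `x ^ r E_{1j}`. -/
def iterProd (k : Type u) [Field k] {A : Type v} [AddCommGroup A] [Module k A]
    [ConformalOps k A] (t v : A) : ℕ → A
  | 0 => v
  | r + 1 => nProd k 0 t (iterProd k t v r)

theorem iterProd_mem_span (t v : A) (r : ℕ) :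
    iterProd k t v r ∈ Submodule.span k (Set.range (iterProd k t v)) :=
  Submodule.subset_span ⟨r, rfl⟩

theorem nProd_mem_span_iterProd {t v a : A}
    (ha : a ∈ Submodule.span k (Set.range (iterProd k t v))) :
    nProd k 0 t a ∈ Submodule.span k (Set.range (iterProd k t v)) :=
  apply_mem_span_range (ConformalOps.nProd 0 t) (fun r => iterProd_mem_span t v (r + 1)) ha

namespace IsCornerSystem
variable {z l : Fin n} {u v : Fin n → A} [IsAssocConformal k A]

/-- The product `u_i ∘_λ v_j` does not depend on `λ`: insert `e_{11}` between the factors. -/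
theorem nProd_u_v_succ (h : IsCornerSystem k z u v) (i j : Fin n) (m : ℕ) :
    nProd k (m + 1) (u i) (v j) = 0 := by
  have h1 := nProd_zero_nProd (k := k) (m + 1) (u i) (v z) (v j)
  rw [h.u_unit, h.unit_v] at h1
  rw [← h1]
  cases m <;> exact nProd_zero 0 _

/-- `e_{11} ∘_λ x_{11} = x_{11} + λ e_{11}`. -/
theorem nProd_unit_corner (h : IsCornerSystem k z u v) (l : Fin n) (m : ℕ) :
    nProd k m (v z) (nProd k 0 (v l) (u l)) = nProd k m (v l) (u l) := by
  rw [nProd_nProd_zero_of_const (fun q => ?_), h.unit_v, lamPoly]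
  rw [h.unit_v]
  cases q <;> rfl

/-- `x_{11} ∘_0 e_{11} = x_{11}`. -/
theorem nProd_corner_unit (h : IsCornerSystem k z u v) (l : Fin n) :
    nProd k 0 (nProd k 0 (v l) (u l)) (v z) = nProd k 0 (v l) (u l) := by
  rw [← nProd_zero_nProd, h.u_unit]

theorem nProd_corner_v_succ (h : IsCornerSystem k z u v) (l j : Fin n) (m : ℕ) :
    nProd k (m + 1) (nProd k 0 (v l) (u l)) (v j) = 0 := by
  rw [← nProd_zero_nProd, h.nProd_u_v_succ, nProd_zero]

/-- `x_{11} ∘_λ x_{11} = x_{11} ∘_0 x_{11} + λ x_{11}`. Locality of this pair is a consequence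
of `x_{11} = x_{11} ∘_0 e_{11}` and of the products `e_{1n} ∘_m x_{n1}`. -/
theorem nProd_corner_corner (h : IsCornerSystem k z u v) (hl : l.val + 1 = n) (m : ℕ) :
    nProd k m (nProd k 0 (v l) (u l)) (nProd k 0 (v l) (u l)) =
      lamPoly (nProd k 0 (nProd k 0 (v l) (u l)) (nProd k 0 (v l) (u l)))
        (nProd k 0 (v l) (u l)) m := by
  rw [nProd_nProd_zero_of_const (h.nProd_corner_v_succ l l), ← nProd_zero_nProd]
  rcases m with _ | _ | m
  · rfl
  · rw [h.v_u_one l hl]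
    exact h.nProd_corner_unit l
  · rw [h.v_u_add_two l hl]
    exact nProd_zero 0 _

theorem nProd_corner_mem (h : IsCornerSystem k z u v) (hl : l.val + 1 = n) (j : Fin n)
    (m r : ℕ) : nProd k m (nProd k 0 (v l) (u l)) (iterProd k (nProd k 0 (v l) (u l)) (v j) r) ∈
      Submodule.span k (Set.range (iterProd k (nProd k 0 (v l) (u l)) (v j))) := by
  induction r generalizing m with
  | zero =>
    rcases m with _ | m
    · exact iterProd_mem_span _ _ 1
    · rw [iterProd, h.nProd_corner_v_succ]
      exact zero_mem _
  | succ r ih =>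
    rw [iterProd]
    refine nProd_nProd_mem_of_left (fun q s => ?_) m 0
    rw [h.nProd_corner_corner hl]
    rcases q with _ | _ | q
    · rw [lamPoly, ← nProd_zero_nProd]
      exact nProd_mem_span_iterProd (ih s)
    · exact ih s
    · rw [lamPoly, zero_nProd]
      exact zero_mem _

theorem nProd_unit_mem (h : IsCornerSystem k z u v) (hl : l.val + 1 = n) (j : Fin n)
    (m r : ℕ) : nProd k m (v z) (iterProd k (nProd k 0 (v l) (u l)) (v j) r) ∈
      Submodule.span k (Set.range (iterProd k (nProd k 0 (v l) (u l)) (v j))) := by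
  induction r generalizing m with
  | zero =>
    rw [iterProd, h.unit_v]
    rcases m with _ | _ | m
    · exact iterProd_mem_span _ _ 0
    · exact zero_mem _
    · exact zero_mem _
  | succ r ih =>
    rw [iterProd]
    refine nProd_nProd_mem_of_left (fun q s => ?_) m 0
    rw [h.nProd_unit_corner]
    rcases q with _ | _ | q
    · exact h.nProd_corner_mem hl j s r
    · rw [h.v_u_one l hl]
      exact ih s
    · rw [h.v_u_add_two l hl, zero_nProd]
      exact zero_mem _

/-- `e_{11}` is a left unit for the elements representing `x ^ r E_{1j}`. -/
theorem nProd_unit_iterProd (h : IsCornerSystem k z u v) (l j : Fin n) (r : ℕ) :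
    nProd k 0 (v z) (iterProd k (nProd k 0 (v l) (u l)) (v j) r) =
      iterProd k (nProd k 0 (v l) (u l)) (v j) r := by
  cases r with
  | zero => rw [iterProd, h.unit_v, lamPoly]
  | succ r => rw [iterProd, nProd_zero_nProd, h.nProd_unit_corner]

/-- Multiplication by `v_p` takes `u_i ∘_0 (x ^ r E_{1j})` to the first row. -/
theorem nProd_v_mem (h : IsCornerSystem k z u v) (hl : l.val + 1 = n) (p i j : Fin n)
    (m r : ℕ) :
    nProd k m (v p) (nProd k 0 (u i) (iterProd k (nProd k 0 (v l) (u l)) (v j) r)) ∈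
      Submodule.span k (Set.range (iterProd k (nProd k 0 (v l) (u l)) (v j))) := by
  refine nProd_nProd_mem_of_left (fun q s => ?_) m 0
  by_cases hpi : p = i
  · subst hpi
    by_cases hp : p.val + 1 < n
    · rw [h.v_u_lt p hp]
      rcases q with _ | _ | q
      · exact h.nProd_unit_mem hl j s r
      · rw [lamPoly, zero_nProd]
        exact zero_mem _
      · rw [lamPoly, zero_nProd]
        exact zero_mem _
    · obtain rfl : p = l := Fin.ext (by omega)
      rcases q with _ | _ | q
      · exact h.nProd_corner_mem hl j s r
      · rw [h.v_u_one p hl]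
        exact h.nProd_unit_mem hl j s r
      · rw [h.v_u_add_two p hl, zero_nProd]
        exact zero_mem _
  · rw [h.v_u_ne p i hpi, zero_nProd]
    exact zero_mem _

/-- The elements `u_i ∘_0 (x_{11} ∘_0 ⋯ (x_{11} ∘_0 v_j))` span the algebra over `k[∂]`. -/
theorem delSpan_eq_top (h : IsCornerSystem k z u v) (hl : l.val + 1 = n)
    {X : Type*} {g : X → A} (hg : Generates k g)
    (hgen : ∀ x, (∃ i, g x = u i) ∨ (∃ j, g x = v j) ∨ ∃ i j, g x = nProd k 0 (u i) (v j)) :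
    delSpan k (fun p : ℕ × Fin n × Fin n =>
      nProd k 0 (u p.2.1) (iterProd k (nProd k 0 (v l) (u l)) (v p.2.2) p.1)) = ⊤ := by
  set F := fun p : ℕ × Fin n × Fin n =>
    nProd k 0 (u p.2.1) (iterProd k (nProd k 0 (v l) (u l)) (v p.2.2) p.1) with hF
  have hu : ∀ i j, ∀ a ∈ Submodule.span k (Set.range (iterProd k (nProd k 0 (v l) (u l)) (v j))),
      nProd k 0 (u i) a ∈ delSpan k F := fun i j a ha =>
    apply_mem_span_range (ConformalOps.nProd 0 (u i)) (fun r => mem_delSpan F (r, i, j)) ha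
  have hrow : ∀ j, Submodule.span k (Set.range (iterProd k (nProd k 0 (v l) (u l)) (v j))) ≤
      delSpan k F := fun j => Submodule.span_le.2 (Set.range_subset_iff.2 fun r => by
    have h1 := mem_delSpan (k := k) F (r, z, j)
    have h2 : F (r, z, j) = iterProd k (nProd k 0 (v l) (u l)) (v j) r := by
      rw [hF, ← h.nProd_unit_iterProd l j r, ← h.u_first]
    rwa [h2] at h1)
  refine _root_.delSpan_eq_top hg (fun x => ?_) ?_
  · obtain ⟨i, hi⟩ | ⟨j, hj⟩ | ⟨i, j, hij⟩ := hgen x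
    · rw [hi, ← h.u_unit]
      exact mem_delSpan F (0, i, z)
    · rw [hj]
      exact hrow j (iterProd_mem_span _ _ 0)
    · rw [hij]
      exact mem_delSpan F (0, i, j)
  · rintro x m ⟨r, p, q⟩
    obtain ⟨i, hi⟩ | ⟨j, hj⟩ | ⟨i, j, hij⟩ := hgen x
    -- `u_i = u_i ∘_0 v_1`, and `v_1` takes the product to the first row.
    · rw [hi, ← h.u_unit, ← nProd_zero_nProd]
      exact hu i q _ (h.nProd_v_mem hl z p q m r)
    · rw [hj]
      exact hrow q (h.nProd_v_mem hl j p q m r)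
    · rw [hij, ← nProd_zero_nProd]
      exact hu i q _ (h.nProd_v_mem hl j p q m r)

end IsCornerSystem

theorem map_iterProd {f : A →ₗ[k] Cend k n} (hf : IsConfHom f) {z l : Fin n} {u v : Fin n → A}
    (hl : l.val + 1 = n)
    (hu : ∀ i, f (u i) = Matrix.single i z (PolyDX.ofX k (diagEntry k i)))
    (hv : ∀ j, f (v j) = Matrix.single z j 1) (r : ℕ) (i j : Fin n) :
    f (nProd k 0 (u i) (iterProd k (nProd k 0 (v l) (u l)) (v j) r)) =
      Matrix.single i j (PolyDX.ofX k (diagEntry k i) * PolyDX.ofX k (X ^ r)) := by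
  have ht : f (nProd k 0 (v l) (u l)) = Matrix.single z z (PolyDX.ofX k X) := by
    rw [hf.map_nProd, hv, hu, nProd_single, if_pos rfl, diagEntry, if_pos hl,
      ← map_one (PolyDX.ofX k), scProd_zero_ofX, map_one, one_mul]
  have hi : f (iterProd k (nProd k 0 (v l) (u l)) (v j) r) =
      Matrix.single z j (PolyDX.ofX k (X ^ r)) := by
    induction r with
    | zero => rw [iterProd, hv, pow_zero, map_one]
    | succ r ih =>
      rw [iterProd, hf.map_nProd, ht, ih, nProd_single, if_pos rfl, scProd_zero_ofX, pow_succ',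
        map_mul]
  rw [hf.map_nProd, hu, hi, nProd_single, if_pos rfl, scProd_zero_ofX]

end CornerSystem

/-- The relations hold in `Cend_n`. -/
theorem DefRel'.map_eq {k : Type u} [Field k] {n : ℕ} {h2 : 2 ≤ n} {N : ℕ}
    {f : ConfAs k (Gen' n) N →ₗ[k] Cend k n} (hf : IsConfHom f)
    (hfg : ∀ g : Gen' n, f (ConfAs.of k N g) = (g.toGen h2).toMatrix k)
    {a b : ConfAs k (Gen' n) N} (hab : DefRel' k n h2 N a b) : f a = f b := by
  let z : Fin n := ⟨0, by omega⟩
  let l : Fin n := ⟨n - 1, by omega⟩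
  have hz : z.val + 1 < n := show 0 + 1 < n by omega
  have hl : l.val + 1 = n := show n - 1 + 1 = n by omega
  have he : ∀ i j hi hj, f (eSym' k N i j hi hj) = Matrix.single i j 1 :=
    fun i j hi hj => hfg _
  have he' : f (e11Sym' k N h2) = Matrix.single z z 1 := hfg _
  have hv : f (e1nSym' k n N) = Matrix.single z l 1 := hfg _
  have hx : f (xn1Sym' k n N) = Matrix.single l z (PolyDX.px k) := hfg _
  cases hab with
  | ee i j p q hi hj hp hq m =>
    rw [hf.map_nProd, map_lamPoly, apply_ite f, he, he, he, nProd_single, scProd_one_one, map_zero]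
    rcases m with _ | _ | m <;> simp [lamPoly]
  | e1n_e i j hi hj m =>
    rw [hf.map_nProd, hv, he, nProd_single, if_neg (fun h => by rw [← h] at hi; omega), map_zero]
  | e11_e1n m =>
    rw [hf.map_nProd, map_lamPoly, he', hv, nProd_single, if_pos rfl, scProd_one_one, map_zero]
    rcases m with _ | _ | m <;> simp [lamPoly]
  | e_xn1 i j hi hj m =>
    rw [hf.map_nProd, hx, he, nProd_single, if_neg (fun h => by rw [h] at hj; omega), map_zero]
  | xn1_e11 m =>
    rw [hf.map_nProd, map_lamPoly, he', hx, nProd_single, if_pos rfl, scProd_px_one, map_zero]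
    rcases m with _ | _ | m <;> simp [lamPoly]
  | e1n_xn1_one =>
    rw [hf.map_nProd, hv, hx, he', nProd_single, if_pos rfl, scProd_one_px, lamPoly]
  | e1n_xn1_gt m hm =>
    obtain ⟨m, rfl⟩ := Nat.exists_eq_add_of_le' hm
    rw [hf.map_nProd, hv, hx, nProd_single, if_pos rfl, scProd_one_px, lamPoly,
      Matrix.single_zero, map_zero]

theorem isPresentedBy_genCendQ_toGen (k : Type u) [Field k] {n : ℕ} (h2 : 2 ≤ n) {N : ℕ}
    (hN : 2 ≤ N) :
    IsPresentedBy (fun g : Gen' n => genCendQ k (g.toGen h2)) N (DefRel' k n h2 N) := by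
  let z : Fin n := ⟨0, by omega⟩
  let l : Fin n := ⟨n - 1, by omega⟩
  have hz : z.val + 1 < n := show 0 + 1 < n by omega
  have hl : l.val + 1 = n := show n - 1 + 1 = n by omega
  let π := (relIdeal (DefRel' k n h2 N)).toSubmodule.mkQ
  let u : Fin n → ConfAsRel (DefRel' k n h2 N) := fun i =>
    if hi : i.val + 1 < n then π (eSym' k N i z hi hz) else π (xn1Sym' k n N)
  let v : Fin n → ConfAsRel (DefRel' k n h2 N) := fun j =>
    if hj : j.val + 1 < n then π (eSym' k N z j hz hj) else π (e1nSym' k n N)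
  have hu : ∀ i hi, u i = π (eSym' k N i z hi hz) := fun i hi => dif_pos hi
  have hu' : ∀ i : Fin n, ¬ i.val + 1 < n → u i = π (xn1Sym' k n N) := fun i hi => dif_neg hi
  have hv : ∀ j hj, v j = π (eSym' k N z j hz hj) := fun j hj => dif_pos hj
  have hv' : ∀ j : Fin n, ¬ j.val + 1 < n → v j = π (e1nSym' k n N) := fun j hj => dif_neg hj
  have hee : ∀ i j p q hi hj hp hq m, nProd k m (π (eSym' k N i j hi hj)) (π (eSym' k N p q hp hq))
      = lamPoly (if j = p then π (eSym' k N i q hi hq) else 0) 0 m := by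
    intro i j p q hi hj hp hq m
    refine (toQuo_eq_of_rel (DefRel'.ee i j p q hi hj hp hq m)).trans
      ((map_lamPoly _ _ _ _).trans ?_)
    rw [apply_ite (relIdeal (DefRel' k n h2 N)).toSubmodule.mkQ, map_zero]
  have huv : IsCornerSystem k z u v :=
    { u_first := by rw [hu z hz, hv z hz]
      u_unit := fun i => by
        rw [hv z hz]
        by_cases hi : i.val + 1 < n
        · rw [hu i hi, hee, if_pos rfl, lamPoly]
        · rw [hu' i hi]
          exact toQuo_eq_of_rel (DefRel'.xn1_e11 0)
      unit_v := fun j m => by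
        rw [hv z hz]
        by_cases hj : j.val + 1 < n
        · rw [hv j hj, hee, if_pos rfl]
        · rw [hv' j hj]
          refine (toQuo_eq_of_rel (DefRel'.e11_e1n m)).trans ((map_lamPoly _ _ _ _).trans ?_)
          rw [map_zero]
      v_u_ne := fun p i hpi m => by
        by_cases hp : p.val + 1 < n
        · rw [hv p hp]
          by_cases hi : i.val + 1 < n
          · rw [hu i hi, hee, if_neg hpi]
            rcases m with _ | _ | m <;> rfl
          · rw [hu' i hi]
            exact (toQuo_eq_of_rel (DefRel'.e_xn1 z p hz hp m)).trans (map_zero _)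
        · rw [hv' p hp]
          have hi : i.val + 1 < n := by
            by_contra hi
            exact hpi (Fin.ext (by omega))
          rw [hu i hi]
          exact (toQuo_eq_of_rel (DefRel'.e1n_e i z hi hz m)).trans (map_zero _)
      v_u_lt := fun p hp m => by
        rw [hv p hp, hu p hp, hee, if_pos rfl, hv z hz]
      v_u_one := fun p hp => by
        rw [hv' p hp.not_lt, hu' p hp.not_lt, hv z hz]
        exact toQuo_eq_of_rel DefRel'.e1n_xn1_one
      v_u_add_two := fun p hp m => by
        rw [hv' p hp.not_lt, hu' p hp.not_lt]
        exact (toQuo_eq_of_rel (DefRel'.e1n_xn1_gt (m + 2) (by omega))).trans (map_zero _) }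
  refine isPresentedBy_of_delSpan _ _
    (fun a b m hm => Subtype.ext (nProd_toMatrix_of_two_le _ _ (hN.trans hm))) ?_
    (fun r i j => nProd k 0 (u i) (iterProd k (nProd k 0 (v l) (u l)) (v j) r)) ?_
    (huv.delSpan_eq_top hl (generates_confAsRel _) ?_)
  · exact fun f hf hfg a b hab => hab.map_eq hf hfg
  · intro f hf hfg
    refine map_iterProd (z := z) hf hl (fun i => ?_) (fun j => ?_)
    · rw [diagEntry]
      by_cases hi : i.val + 1 < n
      · rw [hu i hi, if_neg hi.ne, map_one]
        exact hfg _
      · obtain rfl : i = l := Fin.ext (by omega)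
        rw [hu' l hi, if_pos hl]
        exact hfg _
    · by_cases hj : j.val + 1 < n
      · rw [hv j hj]
        exact hfg _
      · obtain rfl : j = l := Fin.ext (by omega)
        rw [hv' l hj]
        exact hfg _
  · rintro (⟨i, j, hi, hj⟩ | _ | _)
    · refine Or.inr (Or.inr ⟨i, j, ?_⟩)
      rw [hu i hi, hv j hj, hee, if_pos rfl]
      rfl
    · exact Or.inr (Or.inl ⟨l, (hv' l hl.not_lt).symm⟩)
    · exact Or.inl ⟨l, (hu' l hl.not_lt).symm⟩

end

/-- The associative conformal algebra `Cend_{n,Q}`, `Q = diag(1, …, 1, x)`, is generated by the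
elements `e_{ij}` (`i < n`) and `x_{ij}` relative to the relations `DefRel` (with locality bound
`2`); if `n ≥ 2`, it is also generated by `e_{ij}` (`i, j < n`), `e_{1n}`, `x_{n1}` relative to the
relations `DefRel'` (with any locality bound `N ≥ 2`). -/
theorem mainTheorem3 (k : Type*) [Field k] [IsAlgClosed k] [CharZero k] (n : ℕ) (hn : 1 ≤ n) :
    IsPresentedBy (genCendQ k (n := n)) 2 (DefRel k n) ∧
    ∀ (h2 : 2 ≤ n) (N : ℕ), 2 ≤ N →
      IsPresentedBy (fun g : Gen' n => genCendQ k (g.toGen h2)) N (DefRel' k n h2 N) :=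
  ⟨isPresentedBy_genCendQ k n, fun h2 _ hN => isPresentedBy_genCendQ_toGen k h2 hN⟩
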